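/- Let $(M,\omega)$ be a symplectic manifold (possibly non-compact), let $N\ge 1$, and let $X_1,\dots,X_N\subseteq M$ be compact subsets that intersect cyclically: $X_i\cap X_j=\emptyset$ whenever $i\notin\{j-1,j,j+1\}$, indices being taken modulo $N$. A marked domain $\boldsymbol\Delta=(\Delta,p_1,\dots,p_N)$ consists of a compact convex set $\Delta\subset\mathbb{R}^2$ with $\operatorname{Area}(\Delta)=1$ whose boundary is either smooth or polygonal, together with distinct points $p_1,\dots,p_N\in\partial\Delta$ in cyclic counterclockwise order. Let $\gamma_i\subset\partial\Delta$ be the closed counterclockwise boundary arc from $p_i$ to $p_{i+1}$ (indices modulo $N$; if $N=1$, then $\gamma_1=\partial\Delta$). Let $\mathcal F'_{\boldsymbol\Delta,N}(X_1,\dots,X_N)$ be the set of smooth maps $\Phi=(\Phi_1,\Phi_2)\colon M\to\mathbb{R}^2$ with $\Phi(M)\subseteq\Delta$ such that 1. there is a point $q=(q_1,q_2)\in\Delta$ for which $\Phi_1-q_1$ and $\Phi_2-q_2$ are compactly supported, and 2. for each $i$ there is an open set $U_i\supseteq X_i$ with $\Phi(U_i)\subseteq\gamma_i$. Define $$\mathrm{Pb}_N^{\boldsymbol\Delta}(X_1,\dots,X_N)=\inf_{\Phi\in\mathcal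 F'_{\boldsymbol\Delta,N}(X_1,\dots,X_N)}\ \sup_{x\in M}\bigl|\{\Phi_1,\Phi_2\}(x)\bigr|\in[0,\infty],$$ where $\{\cdot,\cdot\}$ is the Poisson bracket of $(M,\omega)$ and $\inf\emptyset=\infty$. Then for any two marked domains $\boldsymbol\Delta_1,\boldsymbol\Delta_2$ with $N$ marked points, $$\mathrm{Pb}_N^{\boldsymbol\Delta_1}(X_1,\dots,X_N)=\mathrm{Pb}_N^{\boldsymbol\Delta_2}(X_1,\dots,X_N).$$ That is, the invariant depends neither on the domain $\Delta$ nor on the marked points, as long as their cyclic counterclockwise order is kept. -/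

import Mathlib

open Set MeasureTheory
open scoped Manifold ContDiff ENNReal

noncomputable section

namespace PoissonInv

section Symplectic

variable {E : Type*} [NormedAddCommGroup E] [NormedSpace ℝ E]
  {M : Type*} [TopologicalSpace M] [ChartedSpace E M]

/-- The expression of a 2-form `α` on `M` in the preferred chart at `x₀`, i.e. its pullback under
the inverse of that chart. It is meaningful on the (open) target of the chart. -/
def chartRep (α : ∀ x : M, (TangentSpace 𝓘(ℝ, E) x) [⋀^Fin 2]→L[ℝ] ℝ) (x₀ : M) (y : E) :
    E [⋀^Fin 2]→L[ℝ] ℝ :=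
  (α ((chartAt E x₀).symm y)).compContinuousLinearMap
    (mfderiv 𝓘(ℝ, E) 𝓘(ℝ, E) (chartAt E x₀).symm y)

variable (E M) in
/-- A symplectic form on `M`: a smooth, closed, nondegenerate differential 2-form. -/
structure SymplecticForm where
  /-- the alternating bilinear form on each tangent space -/
  form : ∀ x : M, (TangentSpace 𝓘(ℝ, E) x) [⋀^Fin 2]→L[ℝ] ℝ
  smooth : ∀ x₀ : M, ContDiffOn ℝ ∞ (chartRep form x₀) (chartAt E x₀).target
  closed : ∀ x₀ : M, ∀ y ∈ (chartAt E x₀).target, extDeriv (chartRep form x₀) y = 0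
  nondegenerate : ∀ (x : M) (v : TangentSpace 𝓘(ℝ, E) x), (∀ w, form x ![v, w] = 0) → v = 0

namespace SymplecticForm

variable (Ω : SymplecticForm E M)

/-- The linear map `v ↦ Ω(v, ·)` from the tangent space at `x` to its dual. -/
def flat (x : M) : TangentSpace 𝓘(ℝ, E) x →ₗ[ℝ] Module.Dual ℝ (TangentSpace 𝓘(ℝ, E) x) :=
  have e₀ : ∀ v w z : TangentSpace 𝓘(ℝ, E) x, Function.update ![v, w] 0 z = ![z, w] := by
    intro v w z; funext i; fin_cases i <;> rfl
  have e₁ : ∀ v w z : TangentSpace 𝓘(ℝ, E) x, Function.update ![v, w] 1 z = ![v, z] := by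
    intro v w z; funext i; fin_cases i <;> rfl
  LinearMap.mk₂ ℝ (fun v w => Ω.form x ![v, w])
    (fun a b w => by
      have h := (Ω.form x).map_update_add ![a, w] 0 a b
      rwa [e₀, e₀, e₀] at h)
    (fun c a w => by
      have h := (Ω.form x).map_update_smul ![a, w] 0 c a
      rwa [e₀, e₀] at h)
    (fun v a b => by
      have h := (Ω.form x).map_update_add ![v, a] 1 a b
      rwa [e₁, e₁, e₁] at h)
    (fun c v a => by
      have h := (Ω.form x).map_update_smul ![v, a] 1 c a
      rwa [e₁, e₁] at h)

@[simp] theorem flat_apply (x : M) (v w : TangentSpace 𝓘(ℝ, E) x) :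
    Ω.flat x v w = Ω.form x ![v, w] := rfl

theorem flat_injective (x : M) : Function.Injective (Ω.flat x) := by
  rw [injective_iff_map_eq_zero]
  intro v hv
  exact Ω.nondegenerate x v fun w => by rw [← Ω.flat_apply, hv]; rfl

variable [FiniteDimensional ℝ E]

/-- Nondegeneracy makes `v ↦ Ω(v, ·)` an isomorphism onto the dual. -/
def flatEquiv (x : M) :
    TangentSpace 𝓘(ℝ, E) x ≃ₗ[ℝ] Module.Dual ℝ (TangentSpace 𝓘(ℝ, E) x) :=
  haveI : FiniteDimensional ℝ (TangentSpace 𝓘(ℝ, E) x) := inferInstanceAs (FiniteDimensional ℝ E)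
  LinearEquiv.ofInjectiveOfFinrankEq (Ω.flat x) (Ω.flat_injective x)
    Subspace.dual_finrank_eq.symm

/-- The differential of `F` at `x`, as a linear functional on the tangent space. -/
def dAt (F : M → ℝ) (x : M) : Module.Dual ℝ (TangentSpace 𝓘(ℝ, E) x) :=
  (show TangentSpace 𝓘(ℝ, E) x →L[ℝ] ℝ from mfderiv 𝓘(ℝ, E) 𝓘(ℝ, ℝ) F x).toLinearMap

/-- The Hamiltonian vector field `X_F` of `F`, with the convention `Ω(X_F, ·) = -dF`. -/
def hamVF (F : M → ℝ) (x : M) : TangentSpace 𝓘(ℝ, E) x :=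
  (Ω.flatEquiv x).symm (-dAt F x)

theorem form_hamVF (F : M → ℝ) (x : M) (w : TangentSpace 𝓘(ℝ, E) x) :
    Ω.form x ![Ω.hamVF F x, w] = -dAt F x w := by
  have h : Ω.flatEquiv x (Ω.hamVF F x) = -dAt F x := (Ω.flatEquiv x).apply_symm_apply _
  exact congrArg (fun l => l w) h

/-- The Poisson bracket `{F, G} = Ω(X_G, X_F)`. -/
def poisson (F G : M → ℝ) (x : M) : ℝ :=
  Ω.form x ![Ω.hamVF G x, Ω.hamVF F x]

end SymplecticForm

end Symplectic

/-- `z` lies on the open ray that starts at `o` and has direction angle `θ`. -/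
def OnRay (o : ℝ × ℝ) (θ : ℝ) (z : ℝ × ℝ) : Prop :=
  ∃ r : ℝ, 0 < r ∧ z = (o.1 + r * Real.cos θ, o.2 + r * Real.sin θ)

/-- The boundary of the planar set `Δ` is smooth: near each of its points it is the zero set of a
smooth function with non-vanishing differential. -/
def HasSmoothBoundary (Δ : Set (ℝ × ℝ)) : Prop :=
  ∀ z ∈ frontier Δ, ∃ (U : Set (ℝ × ℝ)) (f : ℝ × ℝ → ℝ), IsOpen U ∧ z ∈ U ∧
    ContDiffOn ℝ ∞ f U ∧ fderiv ℝ f z ≠ 0 ∧ ∀ w ∈ U, w ∈ frontier Δ ↔ f w = 0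

/-- `Δ` is a convex polygon: the convex hull of a finite set of points. -/
def IsConvexPolygon (Δ : Set (ℝ × ℝ)) : Prop :=
  ∃ V : Finset (ℝ × ℝ), Δ = convexHull ℝ (V : Set (ℝ × ℝ))

/-- The closed counterclockwise arc from `p` to `q` along the boundary of the convex body `Δ`.
Seen from an interior point `o` of `Δ`, the boundary winds once counterclockwise around `o`, each
ray from `o` meeting it in exactly one point; the arc does not depend on `o`. -/
def ccwArc (Δ : Set (ℝ × ℝ)) (p q : ℝ × ℝ) : Set (ℝ × ℝ) :=
  {z | z ∈ frontier Δ ∧ ∃ o ∈ interior Δ, ∃ a b c : ℝ, a ≤ c ∧ c ≤ b ∧ b ≤ a + 2 * Real.pi ∧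
    OnRay o a p ∧ OnRay o c z ∧ OnRay o b q}

/-- The points `p 0, …, p (N-1)` are distinct and ordered cyclically counterclockwise around an
interior point of `Δ`. -/
def CcwOrdered {N : ℕ} (Δ : Set (ℝ × ℝ)) (p : Fin N → ℝ × ℝ) : Prop :=
  ∃ o ∈ interior Δ, ∃ θ : Fin N → ℝ, StrictMono θ ∧ (∀ i j, θ j < θ i + 2 * Real.pi) ∧
    ∀ i, OnRay o (θ i) (p i)

/-- A compact convex planar domain of area `1` with smooth or polygonal boundary, with `N` marked
boundary points in counterclockwise cyclic order. -/
structure MarkedDomain (N : ℕ) where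
  /-- the domain `Δ` -/
  carrier : Set (ℝ × ℝ)
  isCompact : IsCompact carrier
  convex : Convex ℝ carrier
  area : volume carrier = 1
  boundary : HasSmoothBoundary carrier ∨ IsConvexPolygon carrier
  /-- the marked points -/
  point : Fin N → ℝ × ℝ
  point_mem : ∀ i, point i ∈ frontier carrier
  ordered : CcwOrdered carrier point

/-- The boundary arc from the `i`-th marked point to the next one (cyclically). -/
def MarkedDomain.arc {N : ℕ} [NeZero N] (D : MarkedDomain N) (i : Fin N) : Set (ℝ × ℝ) :=
  ccwArc D.carrier (D.point i) (D.point (i + 1))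

/-- `X_i ∩ X_j = ∅` unless `i ∈ {j - 1, j, j + 1}`, indices being taken modulo `N`. -/
def IntersectCyclically {M : Type*} {N : ℕ} [NeZero N] (X : Fin N → Set M) : Prop :=
  ∀ i j, i ≠ j - 1 → i ≠ j → i ≠ j + 1 → X i ∩ X j = ∅

section Invariant

variable {E : Type*} [NormedAddCommGroup E] [NormedSpace ℝ E]
  {M : Type*} [TopologicalSpace M] [ChartedSpace E M]

/-- The (CS)-condition: outside a compact set, `Φ` is constant, with value in `Δ`. -/
def IsCS (Δ : Set (ℝ × ℝ)) (Φ : M → ℝ × ℝ) : Prop :=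
  ∃ p ∈ Δ, HasCompactSupport (fun x => (Φ x).1 - p.1) ∧
    HasCompactSupport (fun x => (Φ x).2 - p.2)

variable (E) in
/-- The class of smooth maps `Φ : M → Δ` that satisfy (CS) and map a neighbourhood of each `X i`
into the `i`-th arc. -/
def admissible {N : ℕ} [NeZero N] (D : MarkedDomain N) (X : Fin N → Set M) : Set (M → ℝ × ℝ) :=
  {Φ | ContMDiff 𝓘(ℝ, E) 𝓘(ℝ, ℝ × ℝ) ∞ Φ ∧ (∀ x, Φ x ∈ D.carrier) ∧ IsCS D.carrier Φ ∧
    ∀ i, ∃ U : Set M, IsOpen U ∧ X i ⊆ U ∧ ∀ x ∈ U, Φ x ∈ D.arc i}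

/-- The invariant `Pb_N`: the infimum over admissible maps of the sup norm of `{Φ₁, Φ₂}`. It takes
values in `[0, ∞]`, and is `∞` if there is no admissible map. -/
def Pb [FiniteDimensional ℝ E] (Ω : SymplecticForm E M) {N : ℕ} [NeZero N]
    (D : MarkedDomain N) (X : Fin N → Set M) : ℝ≥0∞ :=
  ⨅ Φ ∈ admissible E D X, ⨆ x : M, ‖Ω.poisson (fun y => (Φ y).1) (fun y => (Φ y).2) x‖ₑ

end Invariant

end PoissonInv

end

noncomputable section

namespace PoissonInv

/-! ### Smooth functions of one variable -/

/-! If `F` is a smooth map of the plane into `Δ₂` that carries each arc of `Δ₁` into the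
corresponding arc of `Δ₂`, then `Φ ↦ F ∘ Φ` preserves admissibility and multiplies the bracket by
`jac F ∘ Φ` (`SymplecticForm.poisson_comp`). It therefore suffices to find, for each `c > 1`, such
an `F` with `|jac F| ≤ c ^ 6` (`MarkedDomain.exists_map`), then to let `c → 1` and exchange the two
domains. `F` need not be injective, and this freedom makes the construction elementary.

Use polar coordinates about interior points, with radial functions `ρ₁`, `ρ₂`. Choose a smooth `κ`
slightly larger than `1 / ρ₁`, and put `v = r * κ θ`. The radial part of `F` is a step `S v` of
slope at most `c`, flat near `0` (so the origin is harmless) and equal to `1` for `v ≥ 1`. The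
angular part is a monotone circle map `μ` with `ρ₂(μ)² μ' ≤ c⁴ κ⁻²`; it exists because both areas
are `1` (`exists_angle_map_of_bodies`). For `v ≤ 1` the Jacobian is `S' κ S ρ₂(μ)² μ' / r ≤ c ^ 6`.

For `v > 1` the map takes values in the boundary curve of `Δ₂`, so its Jacobian vanishes. Since
`∂Δ₁` lies in `v ≥ 1 + d`, the collar `1 < v < 1 + d` can be used to slide along that curve until
the marked points match, at no cost.

At a corner `ρ₂` is only one-sidedly smooth. Letting `μ` be stationary to infinite order there makes
`ρ₂ ∘ μ` smooth; this is what `HasProfile` organizes. -/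

theorem hasDerivAt_primitive {f : ℝ → ℝ} (hf : Continuous f) (x : ℝ) :
    HasDerivAt (fun x => ∫ t in (0 : ℝ)..x, f t) (f x) x :=
  intervalIntegral.integral_hasDerivAt_right (hf.intervalIntegrable _ _)
    (hf.stronglyMeasurableAtFilter _ _) hf.continuousAt

theorem contDiff_primitive {f : ℝ → ℝ} (hf : ContDiff ℝ ∞ f) :
    ContDiff ℝ ∞ fun x => ∫ t in (0 : ℝ)..x, f t := by
  rw [contDiff_infty_iff_deriv]
  have h := hasDerivAt_primitive hf.continuous
  refine ⟨fun x => (h x).differentiableAt, ?_⟩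
  rwa [show deriv (fun x => ∫ t in (0 : ℝ)..x, f t) = f from funext fun x => (h x).deriv]

/-- A smooth step from `0` to `1` on the unit interval, flat at both ends, with slope at most
`c`, where `c > 1` is arbitrary. -/
theorem exists_smooth_step {c : ℝ} (hc : 1 < c) :
    ∃ S : ℝ → ℝ, ContDiff ℝ ∞ S ∧ Monotone S ∧ (∀ t, deriv S t ≤ c) ∧
      ∃ v > 0, (∀ t ≤ v, S t = 0) ∧ ∀ t, 1 - v ≤ t → S t = 1 := by
  -- The step is the normalized primitive of a bump equal to `1` on `[2d, 1 - 2d]` and zero off `(d,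
  -- 1 - d)`. Its integral `K` is at least `1 - 4d ≥ 1 / c`, so the slope is at most `1 / K ≤ c`.
  obtain ⟨d, hd, hd4, hdc⟩ : ∃ d : ℝ, 0 < d ∧ 8 * d < 1 ∧ 1 ≤ c * (1 - 4 * d) := by
    refine ⟨(1 - c⁻¹) / 8, ?_, ?_, ?_⟩
    · have := inv_lt_one_of_one_lt₀ hc
      linarith
    · have : 0 < c⁻¹ := by positivity
      linarith
    · have : c * c⁻¹ = 1 := mul_inv_cancel₀ (by positivity)
      nlinarith
  let ψ : ContDiffBump (1 / 2 : ℝ) := ⟨1 / 2 - 2 * d, 1 / 2 - d, by linarith, by linarith⟩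
  have hψ : ContDiff ℝ ∞ ψ := ψ.contDiff
  have hint : ∀ a b, IntervalIntegrable ψ volume a b := fun a b =>
    hψ.continuous.intervalIntegrable a b
  have hz : ∀ t, t ≤ d ∨ 1 - d ≤ t → ψ t = 0 := by
    intro t ht
    apply ψ.zero_of_le_dist
    rw [Real.dist_eq]
    change 1 / 2 - d ≤ _
    rcases ht with h | h
    · rw [abs_of_nonpos (by linarith)]; linarith
    · rw [abs_of_nonneg (by linarith)]; linarith
  set K : ℝ := ∫ t in (0 : ℝ)..1, ψ t with hK
  have hK1 : 1 - 4 * d ≤ K := by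
    have h1 : ∫ t in (2 * d)..(1 - 2 * d), ψ t = ∫ t in (2 * d)..(1 - 2 * d), (1 : ℝ) := by
      apply intervalIntegral.integral_congr
      intro t ht
      rw [uIcc_of_le (by linarith)] at ht
      apply ψ.one_of_mem_closedBall
      rw [Metric.mem_closedBall, Real.dist_eq]
      change _ ≤ 1 / 2 - 2 * d
      rw [abs_le]
      constructor <;> linarith [ht.1, ht.2]
    have h2 : ∫ t in (2 * d)..(1 - 2 * d), ψ t ≤ K :=
      intervalIntegral.integral_mono_interval (by linarith) (by linarith) (by linarith)
        (Filter.Eventually.of_forall fun _ => ψ.nonneg) (hint _ _)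
    rw [h1, intervalIntegral.integral_const, smul_eq_mul] at h2
    linarith
  have hK0 : 0 < K := by linarith
  have hder : ∀ t, HasDerivAt (fun x => K⁻¹ * ∫ t in (0 : ℝ)..x, ψ t) (K⁻¹ * ψ t) t := fun t =>
    (hasDerivAt_primitive hψ.continuous t).const_mul _
  refine ⟨fun x => K⁻¹ * ∫ t in (0 : ℝ)..x, ψ t, contDiff_const.mul (contDiff_primitive hψ), ?_,
    ?_, d, hd, ?_, ?_⟩
  · apply monotone_of_deriv_nonneg fun t => (hder t).differentiableAt
    intro t
    rw [(hder t).deriv]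
    exact mul_nonneg (by positivity) ψ.nonneg
  · intro t
    rw [(hder t).deriv]
    calc K⁻¹ * ψ t ≤ K⁻¹ * 1 := by gcongr; exact ψ.le_one
      _ ≤ c := by
        rw [mul_one, inv_le_comm₀ hK0 (by positivity)]
        refine le_trans ?_ hK1
        rw [inv_le_iff_one_le_mul₀ (by positivity)]
        linarith
  · intro t ht
    have : ∫ x in (0 : ℝ)..t, ψ x = ∫ x in (0 : ℝ)..t, (0 : ℝ) := by
      apply intervalIntegral.integral_congr
      intro x hx
      apply hz
      left
      exact hx.2.trans (max_le hd.le ht)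
    simp only [this, intervalIntegral.integral_zero, mul_zero]
  · intro t ht
    have h1 : ∫ x in (1 : ℝ)..t, ψ x = ∫ x in (1 : ℝ)..t, (0 : ℝ) := by
      apply intervalIntegral.integral_congr
      intro x hx
      apply hz
      right
      exact le_trans (le_min (by linarith) ht) hx.1
    have h2 := intervalIntegral.integral_add_adjacent_intervals (hint 0 1) (hint 1 t)
    rw [h1, intervalIntegral.integral_zero, add_zero, ← hK] at h2
    simp only [← h2]
    exact inv_mul_cancel₀ hK0.ne'

/-- A function that is constant outside `(0, L)` extends from `[0, L]` to a function on the line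
that changes by a constant under translation by `L`. -/
theorem exists_equivariant_extension {f : ℝ → ℝ} {L c₀ c₁ : ℝ} (hL : 0 < L)
    (h0 : ∀ t ≤ 0, f t = c₀) (h1 : ∀ t, L ≤ t → f t = c₁) :
    ∃ g : ℝ → ℝ, (∀ t, g (t + L) = g t + (c₁ - c₀)) ∧ (∀ t ∈ Icc 0 L, g t = f t) ∧
      ∀ n : ℤ, ∀ t ∈ Ioo ((n - 1 : ℝ) * L) ((n + 1 : ℝ) * L),
        g t = f (t - n * L) + f (t - n * L + L) - c₁ + n * (c₁ - c₀) := by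
  have key : ∀ n : ℤ, ∀ t, n * L ≤ t → t < (n + 1) * L → ⌊t / L⌋ = n := by
    intro n t h1 h2
    rw [Int.floor_eq_iff, le_div_iff₀ hL, div_lt_iff₀ hL]
    exact ⟨h1, h2⟩
  refine ⟨fun t => f (t - ⌊t / L⌋ * L) + ⌊t / L⌋ * (c₁ - c₀), ?_, ?_, ?_⟩
  · intro t
    have : ⌊(t + L) / L⌋ = ⌊t / L⌋ + 1 := by
      rw [add_div, div_self hL.ne', Int.floor_add_one]
    simp only [this]
    push_cast
    ring_nf
  · rintro t ⟨ht0, ht1⟩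
    rcases ht1.lt_or_eq with h | h
    · simp [key 0 t (by simpa using ht0) (by simpa using h)]
    · subst h
      simp [div_self hL.ne', h0 0 le_rfl, h1 t le_rfl]
  -- On either half of the window one of the two `f` terms is constant: `f (t - n * L + L) = c₁` to
  -- the right of `n * L`, and `f (t - n * L) = c₀` to the left.
  · rintro n t ⟨ht0, ht1⟩
    rcases le_or_gt (n * L) t with h | h
    · simp only [key n t h ht1]
      rw [h1 (t - n * L + L) (by linarith)]
      ring
    · have := key (n - 1) t (by push_cast; exact ht0.le) (by push_cast; linarith)
      simp only [this]
      rw [h0 (t - n * L) (by linarith)]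
      push_cast
      ring_nf

theorem exists_mem_Ioo_int_mul {L : ℝ} (hL : 0 < L) (t : ℝ) :
    ∃ n : ℤ, t ∈ Ioo ((n - 1 : ℝ) * L) ((n + 1 : ℝ) * L) := by
  refine ⟨⌊t / L⌋, ?_, ?_⟩
  · rw [← lt_div_iff₀ hL]
    linarith [Int.floor_le (t / L)]
  · rw [← div_lt_iff₀ hL]
    exact Int.lt_floor_add_one _

/-- The open windows overlap and cover the line, junction points `n * L` included, and on each of
them `g` is a smooth expression in `f`. -/
theorem contDiff_of_equivariant_extension {f g : ℝ → ℝ} {L c₀ c₁ : ℝ} (hL : 0 < L)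
    (hf : ContDiff ℝ ∞ f)
    (hg : ∀ n : ℤ, ∀ t ∈ Ioo ((n - 1 : ℝ) * L) ((n + 1 : ℝ) * L),
        g t = f (t - n * L) + f (t - n * L + L) - c₁ + n * (c₁ - c₀)) :
    ContDiff ℝ ∞ g := by
  rw [contDiff_iff_contDiffAt]
  intro t
  obtain ⟨n, hn⟩ := exists_mem_Ioo_int_mul hL t
  have : ContDiff ℝ ∞ fun t => f (t - n * L) + f (t - n * L + L) - c₁ + n * (c₁ - c₀) := by
    fun_prop
  exact this.contDiffAt.congr_of_eventuallyEq
    (Filter.eventuallyEq_of_mem (Ioo_mem_nhds hn.1 hn.2) (hg n))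

theorem add_int_mul_of_equivariant {g : ℝ → ℝ} {L d : ℝ} (h : ∀ t, g (t + L) = g t + d)
    (n : ℤ) (t : ℝ) : g (t + n * L) = g t + n * d := by
  have hn : ∀ n : ℕ, ∀ t, g (t + n * L) = g t + n * d := by
    intro n
    induction n with
    | zero => simp
    | succ n ih =>
      intro t
      have := h (t + n * L)
      rw [ih] at this
      push_cast
      rw [show t + (n + 1) * L = t + n * L + L by ring, this]
      ring
  obtain ⟨m, rfl | rfl⟩ := n.eq_nat_or_neg
  · exact_mod_cast hn m t
  · have := hn m (t + ((-(m : ℤ) : ℤ) : ℝ) * L)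
    push_cast at this ⊢
    rw [show t + -(m : ℝ) * L + m * L = t by ring] at this
    linarith

theorem monotone_of_equivariant {g : ℝ → ℝ} {L d : ℝ} (hL : 0 < L)
    (hg : ∀ t, g (t + L) = g t + d) (hm : MonotoneOn g (Icc 0 L)) : Monotone g := by
  have hd : 0 ≤ d := by
    have := hm (left_mem_Icc.2 hL.le) (right_mem_Icc.2 hL.le) hL.le
    have h2 := hg 0
    rw [zero_add] at h2
    linarith
  have key : ∀ s, 0 ≤ s → s < L → ∀ t, s ≤ t → g s ≤ g t := by
    intro s hs0 hsL t hst
    have h1 := Int.floor_le (t / L)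
    have h2 := (Int.lt_floor_add_one (t / L)).le
    rw [le_div_iff₀ hL] at h1
    rw [div_le_iff₀ hL] at h2
    have hn : 0 ≤ ⌊t / L⌋ := Int.floor_nonneg.2 (div_nonneg (by linarith) hL.le)
    set n := ⌊t / L⌋
    have ht : g t = g (t - n * L) + n * d := by
      rw [← add_int_mul_of_equivariant hg]; ring_nf
    rcases hn.eq_or_lt with h | h
    · rw [← h] at h1 h2
      apply hm ⟨hs0, hsL.le⟩ ⟨by linarith, by simpa using h2⟩ hst
    · have hn1 : (1 : ℝ) ≤ n := by exact_mod_cast h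
      have e1 : g s ≤ g L := hm ⟨hs0, hsL.le⟩ (right_mem_Icc.2 hL.le) hsL.le
      have e2 : g 0 ≤ g (t - n * L) :=
        hm (left_mem_Icc.2 hL.le) ⟨by linarith, by linarith⟩ (by linarith)
      have e3 : g L = g 0 + d := by rw [← hg 0, zero_add]
      rw [ht]
      nlinarith
  intro s t hst
  have h1 := Int.floor_le (s / L)
  have h2 := (Int.lt_floor_add_one (s / L))
  rw [le_div_iff₀ hL] at h1
  rw [div_lt_iff₀ hL] at h2
  set n := ⌊s / L⌋
  have := key (s - n * L) (by linarith) (by linarith) (t - n * L) (by linarith)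
  have e1 := add_int_mul_of_equivariant hg n (s - n * L)
  have e2 := add_int_mul_of_equivariant hg n (t - n * L)
  rw [sub_add_cancel] at e1 e2
  linarith

/-! ### Planar polar coordinates and Jacobians -/

/-- The unit vector with direction angle `θ`. -/
def dir (θ : ℝ) : ℝ × ℝ := (Real.cos θ, Real.sin θ)

theorem contDiff_dir : ContDiff ℝ ∞ dir := Real.contDiff_cos.prodMk Real.contDiff_sin

theorem dir_add_two_pi (θ : ℝ) : dir (θ + 2 * Real.pi) = dir θ := by
  simp [dir]

theorem dir_add_int_mul (θ : ℝ) (n : ℤ) : dir (θ + n * (2 * Real.pi)) = dir θ := by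
  simp [dir, Real.cos_add_int_mul_two_pi, Real.sin_add_int_mul_two_pi]

theorem onRay_iff {o z : ℝ × ℝ} {θ : ℝ} : OnRay o θ z ↔ ∃ r : ℝ, 0 < r ∧ z = o + r • dir θ := by
  simp [OnRay, dir, Prod.ext_iff]

theorem OnRay.add_int_mul {o z : ℝ × ℝ} {θ : ℝ} (h : OnRay o θ z) (n : ℤ) :
    OnRay o (θ + n * (2 * Real.pi)) z := by
  rw [onRay_iff] at h ⊢
  rwa [dir_add_int_mul]

/-- The point of the complex plane with the given Cartesian coordinates. -/
def toComplex (x : ℝ × ℝ) : ℂ := Complex.equivRealProdCLM.symm x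

theorem contDiff_toComplex : ContDiff ℝ ∞ toComplex :=
  Complex.equivRealProdCLM.symm.contDiff

theorem toComplex_smul_dir (r θ : ℝ) :
    toComplex (r • dir θ) = r * (Complex.cos θ + Complex.sin θ * Complex.I) := by
  apply Complex.ext
  · simp [toComplex, dir, Complex.cos_ofReal_re, Complex.sin_ofReal_re]
  · simp [toComplex, dir, Complex.cos_ofReal_re, Complex.sin_ofReal_re]

theorem eq_norm_smul_dir_arg (x : ℝ × ℝ) :
    x = ‖toComplex x‖ • dir (Complex.arg (toComplex x)) := by
  ext
  · simp [dir, Complex.norm_mul_cos_arg]; simp [toComplex]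
  · simp [dir, Complex.norm_mul_sin_arg]; simp [toComplex]

theorem toComplex_ne_zero {x : ℝ × ℝ} (hx : x ≠ 0) : toComplex x ≠ 0 := by
  rw [toComplex]
  exact fun h => hx (by simpa using h)

theorem exists_onRay {o z : ℝ × ℝ} (h : z ≠ o) : ∃ θ, OnRay o θ z := by
  refine ⟨Complex.arg (toComplex (z - o)), onRay_iff.2 ⟨‖toComplex (z - o)‖, ?_, ?_⟩⟩
  · exact norm_pos_iff.2 (toComplex_ne_zero (sub_ne_zero.2 h))
  · rw [← eq_norm_smul_dir_arg]; abel

/-- The function on the plane given by the expression `H r θ` in polar coordinates. -/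
def ofPolar {V : Type*} (H : ℝ × ℝ → V) (x : ℝ × ℝ) : V :=
  H (‖toComplex x‖, Complex.arg (toComplex x))

theorem periodic_add_int_mul {V : Type*} {H : ℝ × ℝ → V}
    (hper : ∀ r θ, H (r, θ + 2 * Real.pi) = H (r, θ)) (r θ : ℝ) (n : ℤ) :
    H (r, θ + n * (2 * Real.pi)) = H (r, θ) :=
  (show Function.Periodic (fun θ => H (r, θ)) (2 * Real.pi) from hper r).int_mul n θ

theorem ofPolar_smul_dir {V : Type*} {H : ℝ × ℝ → V}
    (hper : ∀ r θ, H (r, θ + 2 * Real.pi) = H (r, θ)) {r : ℝ} (hr : 0 < r) (θ : ℝ) :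
    ofPolar H (r • dir θ) = H (r, θ) := by
  rw [ofPolar, toComplex_smul_dir, Complex.arg_mul_cos_add_sin_mul_I_eq_toIocMod hr]
  have h1 : ‖(r : ℂ) * (Complex.cos θ + Complex.sin θ * Complex.I)‖ = r := by
    rw [norm_mul, Complex.norm_cos_add_sin_mul_I, mul_one, Complex.norm_real, Real.norm_eq_abs,
      abs_of_pos hr]
  rw [h1, toIocMod, sub_eq_add_neg, ← neg_smul, zsmul_eq_mul]
  exact periodic_add_int_mul hper r θ _

/-- Near the origin the function is constant; off the slit the argument is smooth. On the slit, `arg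
(-w) + π` is a smooth branch that differs from `arg w` by a multiple of `2π`, which `H` does not
see. -/
theorem contDiff_ofPolar {V : Type*} [NormedAddCommGroup V] [NormedSpace ℝ V] {H : ℝ × ℝ → V}
    (hH : ContDiff ℝ ∞ H) (hper : ∀ r θ, H (r, θ + 2 * Real.pi) = H (r, θ))
    {r₀ : ℝ} (hr₀ : 0 < r₀) {v : V} (h0 : ∀ r < r₀, ∀ θ, H (r, θ) = v) :
    ContDiff ℝ ∞ (ofPolar H) := by
  rw [contDiff_iff_contDiffAt]
  intro x
  have hnorm : ∀ x : ℝ × ℝ, x ≠ 0 → ContDiffAt ℝ ∞ (fun x => ‖toComplex x‖) x := fun x hx =>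
    (contDiffAt_norm ℝ (toComplex_ne_zero hx)).comp x contDiff_toComplex.contDiffAt
  have harg : ∀ w : ℂ, w ∈ Complex.slitPlane → ContDiffAt ℝ ∞ Complex.arg w := by
    intro w hw
    have h1 : ContDiffAt ℝ ∞ Complex.log w := (Complex.contDiffAt_log hw).restrict_scalars ℝ
    have h2 : ContDiffAt ℝ ∞ (fun w => Complex.imCLM (Complex.log w)) w :=
      Complex.imCLM.contDiff.contDiffAt.comp w h1
    simpa [Complex.log_im] using h2
  by_cases hx : x = 0
  · subst hx
    have hc : Continuous fun x : ℝ × ℝ => ‖toComplex x‖ := contDiff_toComplex.continuous.norm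
    refine (contDiffAt_const (c := v)).congr_of_eventuallyEq ?_
    have : ∀ᶠ x in nhds (0 : ℝ × ℝ), ‖toComplex x‖ < r₀ :=
      hc.continuousAt.eventually_lt continuousAt_const (by simpa [toComplex] using hr₀)
    filter_upwards [this] with x hx
    exact h0 _ hx _
  · by_cases hs : toComplex x ∈ Complex.slitPlane
    · exact hH.contDiffAt.comp x ((hnorm x hx).prodMk
        ((harg _ hs).comp x contDiff_toComplex.contDiffAt))
    · have hneg : -toComplex x ∈ Complex.slitPlane := by
        have h0 := toComplex_ne_zero hx
        rw [Complex.mem_slitPlane_iff] at hs ⊢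
        push Not at hs
        left
        rw [Complex.neg_re]
        rcases hs.1.lt_or_eq with h | h
        · linarith
        · exact absurd (Complex.ext h hs.2) h0
      have hcont : ContDiffAt ℝ ∞
          (fun x => H (‖toComplex x‖, Complex.arg (-toComplex x) + Real.pi)) x := by
        refine hH.contDiffAt.comp x ((hnorm x hx).prodMk (ContDiffAt.add ?_ contDiffAt_const))
        exact ContDiffAt.comp x (f := fun x => -toComplex x) (harg _ hneg)
          contDiff_toComplex.contDiffAt.neg
      refine hcont.congr_of_eventuallyEq ?_
      have : ∀ᶠ y in nhds x, y ≠ 0 := isOpen_ne.mem_nhds hx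
      filter_upwards [this] with y hy
      rw [ofPolar]
      set w := toComplex y
      have hw : w ≠ 0 := toComplex_ne_zero hy
      have e1 : w = (‖w‖ : ℝ) * (Complex.cos ((Complex.arg (-w) + Real.pi : ℝ)) +
          Complex.sin ((Complex.arg (-w) + Real.pi : ℝ)) * Complex.I) := by
        have := Complex.norm_mul_cos_add_sin_mul_I (-w)
        rw [norm_neg] at this
        push_cast
        rw [Complex.cos_add_pi, Complex.sin_add_pi]
        linear_combination this
      have e2 := Complex.arg_mul_cos_add_sin_mul_I_eq_toIocMod (norm_pos_iff.2 hw)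
        (Complex.arg (-w) + Real.pi)
      rw [← e1, toIocMod, sub_eq_add_neg, ← neg_smul, zsmul_eq_mul] at e2
      rw [e2]
      exact periodic_add_int_mul hper _ _ _

/-- The Jacobian determinant of a map of the plane. -/
def jac (F : ℝ × ℝ → ℝ × ℝ) (x : ℝ × ℝ) : ℝ := (fderiv ℝ F x).det

theorem det_eq (A : ℝ × ℝ →L[ℝ] ℝ × ℝ) :
    A.det = (A (1, 0)).1 * (A (0, 1)).2 - (A (0, 1)).1 * (A (1, 0)).2 := by
  rw [ContinuousLinearMap.det, ← LinearMap.det_toMatrix (Module.Basis.finTwoProd ℝ),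
    Matrix.det_fin_two]
  simp [LinearMap.toMatrix_apply]

theorem jac_eq {F : ℝ × ℝ → ℝ × ℝ} {A : ℝ × ℝ →L[ℝ] ℝ × ℝ} {x : ℝ × ℝ}
    (h : HasFDerivAt F A x) :
    jac F x = (A (1, 0)).1 * (A (0, 1)).2 - (A (0, 1)).1 * (A (1, 0)).2 := by
  rw [jac, h.fderiv, det_eq]

/-- Chain rule for `H = ofPolar H ∘ polarCoord.symm`, the polar coordinate map having Jacobian `r`.
-/
theorem jac_ofPolar {H : ℝ × ℝ → ℝ × ℝ} (hF : Differentiable ℝ (ofPolar H))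
    (hper : ∀ r θ, H (r, θ + 2 * Real.pi) = H (r, θ)) {r : ℝ} (hr : 0 < r) (θ : ℝ) :
    jac (ofPolar H) (r • dir θ) * r = jac H (r, θ) := by
  have hpc : ∀ p : ℝ × ℝ, polarCoord.symm p = p.1 • dir p.2 := fun p => by
    simp [polarCoord_symm_apply, dir]
  have h1 : HasFDerivAt (fun p => ofPolar H (polarCoord.symm p))
      ((fderiv ℝ (ofPolar H) (r • dir θ)).comp (fderivPolarCoordSymm (r, θ))) (r, θ) := by
    refine HasFDerivAt.comp (r, θ) (g := ofPolar H) ?_ (hasFDerivAt_polarCoord_symm (r, θ))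
    rw [hpc]
    exact (hF (r • dir θ)).hasFDerivAt
  have h2 : H =ᶠ[nhds (r, θ)] fun p => ofPolar H (polarCoord.symm p) := by
    have : ∀ᶠ p : ℝ × ℝ in nhds (r, θ), 0 < p.1 :=
      continuousAt_const.eventually_lt continuousAt_fst hr
    filter_upwards [this] with p hp
    rw [hpc, ofPolar_smul_dir hper hp]
  rw [jac, jac, (h1.congr_of_eventuallyEq h2).fderiv, ContinuousLinearMap.det,
    ContinuousLinearMap.det, ContinuousLinearMap.toLinearMap_comp, LinearMap.det_comp]
  congr 1
  exact (det_fderivPolarCoordSymm (r, θ)).symm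

/-- The differential factors through a line, so its rank is at most one. -/
theorem jac_eq_zero_of_factor {b : ℝ → ℝ × ℝ} {s : ℝ × ℝ → ℝ} {H : ℝ × ℝ → ℝ × ℝ} {p : ℝ × ℝ}
    (hb : DifferentiableAt ℝ b (s p)) (hs : DifferentiableAt ℝ s p)
    (hH : H =ᶠ[nhds p] fun p => b (s p)) : jac H p = 0 := by
  rw [jac_eq ((hb.hasDerivAt.hasFDerivAt.comp p hs.hasFDerivAt).congr_of_eventuallyEq hH)]
  simp
  ring

/-- The partial derivatives are `q_r b` and `q_θ b + q b'`; the `q_θ` term is parallel to the first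
column and drops out of the determinant. -/
theorem jac_smul {b : ℝ → ℝ × ℝ} {q : ℝ × ℝ → ℝ} {H : ℝ × ℝ → ℝ × ℝ} {r θ : ℝ} {b' : ℝ × ℝ}
    (hb : HasDerivAt b b' θ) {q' : ℝ × ℝ →L[ℝ] ℝ} (hq : HasFDerivAt q q' (r, θ))
    (hH : H =ᶠ[nhds (r, θ)] fun p => q p • b p.2) :
    jac H (r, θ) = q' (1, 0) * q (r, θ) * ((b θ).1 * b'.2 - (b θ).2 * b'.1) := by
  have h1 : HasFDerivAt (fun p : ℝ × ℝ => b p.2) _ (r, θ) :=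
    HasFDerivAt.comp (r, θ) (g := b) hb.hasFDerivAt hasFDerivAt_snd
  rw [jac_eq ((hq.smul h1).congr_of_eventuallyEq hH)]
  simp
  ring

/-! ### The radial function of a planar convex body -/

/-- `Δ` is a compact convex set with interior point `o`. -/
structure IsPointedBody (Δ : Set (ℝ × ℝ)) (o : ℝ × ℝ) : Prop where
  isCompact : IsCompact Δ
  convex : Convex ℝ Δ
  mem_interior : o ∈ interior Δ

/-- The distance from `o` to the boundary of `Δ` in the direction `θ`. -/
def radius (Δ : Set (ℝ × ℝ)) (o : ℝ × ℝ) (θ : ℝ) : ℝ :=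
  (gauge ((Homeomorph.addLeft o) ⁻¹' Δ) (dir θ))⁻¹

theorem radius_add_two_pi (Δ : Set (ℝ × ℝ)) (o : ℝ × ℝ) (θ : ℝ) :
    radius Δ o (θ + 2 * Real.pi) = radius Δ o θ := by
  rw [radius, dir_add_two_pi, radius]

theorem dir_ne_zero (θ : ℝ) : dir θ ≠ 0 := by
  intro h
  simp only [dir, Prod.mk_eq_zero] at h
  have := Real.sin_sq_add_cos_sq θ
  rw [h.1, h.2] at this
  norm_num at this

namespace IsPointedBody

variable {Δ : Set (ℝ × ℝ)} {o : ℝ × ℝ}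

section

variable (h : IsPointedBody Δ o)
include h

theorem convex_preimage : Convex ℝ ((Homeomorph.addLeft o) ⁻¹' Δ) :=
  h.convex.translate_preimage_right o

theorem preimage_mem_nhds : (Homeomorph.addLeft o) ⁻¹' Δ ∈ nhds (0 : ℝ × ℝ) := by
  apply (Homeomorph.addLeft o).continuous.continuousAt.preimage_mem_nhds
  simpa using mem_interior_iff_mem_nhds.1 h.mem_interior

theorem gauge_dir_pos (θ : ℝ) : 0 < gauge ((Homeomorph.addLeft o) ⁻¹' Δ) (dir θ) := by
  rw [gauge_pos (absorbent_nhds_zero h.preimage_mem_nhds)]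
  · exact dir_ne_zero θ
  · rw [NormedSpace.isVonNBounded_iff]
    exact ((Homeomorph.addLeft o).isCompact_preimage.2 h.isCompact).isBounded

theorem radius_pos (θ : ℝ) : 0 < radius Δ o θ := inv_pos.2 (h.gauge_dir_pos θ)

theorem continuous_radius : Continuous (radius Δ o) :=
  ((continuous_gauge h.convex_preimage h.preimage_mem_nhds).comp contDiff_dir.continuous).inv₀
    fun θ => (h.gauge_dir_pos θ).ne'

theorem mem_iff {r : ℝ} (hr : 0 ≤ r) (θ : ℝ) : o + r • dir θ ∈ Δ ↔ r ≤ radius Δ o θ := by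
  have h1 := gauge_le_one_iff_mem_closure (x := r • dir θ) h.convex_preimage h.preimage_mem_nhds
  rw [((Homeomorph.addLeft o).isCompact_preimage.2 h.isCompact).isClosed.closure_eq,
    gauge_smul_of_nonneg hr, smul_eq_mul, ← le_div_iff₀ (h.gauge_dir_pos θ), one_div] at h1
  exact h1.symm

theorem mem_interior_iff {r : ℝ} (hr : 0 ≤ r) (θ : ℝ) :
    o + r • dir θ ∈ interior Δ ↔ r < radius Δ o θ := by
  have h1 := gauge_lt_one_iff_mem_interior (x := r • dir θ) h.convex_preimage h.preimage_mem_nhds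
  rw [← (Homeomorph.addLeft o).preimage_interior,
    gauge_smul_of_nonneg hr, smul_eq_mul, ← lt_div_iff₀ (h.gauge_dir_pos θ), one_div] at h1
  exact h1.symm

theorem mem_frontier_iff {r : ℝ} (hr : 0 ≤ r) (θ : ℝ) :
    o + r • dir θ ∈ frontier Δ ↔ r = radius Δ o θ := by
  rw [h.isCompact.isClosed.frontier_eq, mem_sdiff, h.mem_iff hr, h.mem_interior_iff hr, not_lt,
    le_antisymm_iff]

theorem radius_smul_dir_mem_frontier (θ : ℝ) : o + radius Δ o θ • dir θ ∈ frontier Δ :=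
  (h.mem_frontier_iff (h.radius_pos θ).le θ).2 rfl

theorem onRay_radius (θ : ℝ) : OnRay o θ (o + radius Δ o θ • dir θ) :=
  onRay_iff.2 ⟨_, h.radius_pos θ, rfl⟩

theorem eq_of_onRay {z : ℝ × ℝ} {θ : ℝ} (hz : OnRay o θ z) (hzf : z ∈ frontier Δ) :
    z = o + radius Δ o θ • dir θ := by
  obtain ⟨r, hr, rfl⟩ := onRay_iff.1 hz
  rw [(h.mem_frontier_iff hr.le θ).1 hzf]

theorem ne_of_mem_frontier {z : ℝ × ℝ} (hzf : z ∈ frontier Δ) : z ≠ o := by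
  rintro rfl
  exact hzf.2 h.mem_interior

theorem volume_eq :
    volume Δ = ENNReal.ofReal ((∫ θ in (-Real.pi)..Real.pi, radius Δ o θ ^ 2) / 2) := by
  set K := (Homeomorph.addLeft o) ⁻¹' Δ with hK
  have hKm : MeasurableSet K := ((Homeomorph.addLeft o).isCompact_preimage.2 h.isCompact).measurableSet
  have h1 : volume Δ = volume K := (measure_preimage_add volume o Δ).symm
  have h2 := lintegral_comp_polarCoord_symm (K.indicator fun _ => (1 : ℝ≥0∞))
  rw [lintegral_indicator_const hKm, one_mul] at h2
  have hmeas : Measurable fun p : ℝ × ℝ => ENNReal.ofReal p.1 •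
      K.indicator (fun _ => (1 : ℝ≥0∞)) (polarCoord.symm p) :=
    (ENNReal.measurable_ofReal.comp measurable_fst).smul
      ((measurable_const.indicator hKm).comp continuous_polarCoord_symm.measurable)
  rw [h1, ← h2, polarCoord_target, Measure.volume_eq_prod, ← Measure.prod_restrict,
    lintegral_prod_symm _ hmeas.aemeasurable]
  have h3 : ∀ θ : ℝ, ∫⁻ r in Ioi (0 : ℝ), ENNReal.ofReal r •
      K.indicator (fun _ => (1 : ℝ≥0∞)) (polarCoord.symm (r, θ)) =
      ENNReal.ofReal (radius Δ o θ ^ 2 / 2) := by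
    intro θ
    have e1 : ∀ r ∈ Ioi (0 : ℝ), ENNReal.ofReal r •
        K.indicator (fun _ => (1 : ℝ≥0∞)) (polarCoord.symm (r, θ)) =
        (Iic (radius Δ o θ)).indicator (fun r => ENNReal.ofReal r) r := by
      intro r hr
      have : polarCoord.symm (r, θ) = r • dir θ := by simp [polarCoord_symm_apply, dir]
      rw [this]
      have hm : r • dir θ ∈ K ↔ r ∈ Iic (radius Δ o θ) := h.mem_iff (le_of_lt hr) θ
      by_cases hr2 : r ∈ Iic (radius Δ o θ)
      · rw [indicator_of_mem hr2, indicator_of_mem (hm.2 hr2), smul_eq_mul, mul_one]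
      · rw [indicator_of_notMem hr2, indicator_of_notMem (fun hh => hr2 (hm.1 hh)), smul_zero]
    rw [setLIntegral_congr_fun measurableSet_Ioi e1, setLIntegral_indicator measurableSet_Iic,
      inter_comm, Ioi_inter_Iic, ← ofReal_integral_eq_lintegral_ofReal,
      ← intervalIntegral.integral_of_le (h.radius_pos θ).le, integral_id]
    · simp
    · exact (continuous_id.integrableOn_Icc).mono_set Ioc_subset_Icc_self
    · filter_upwards [ae_restrict_mem measurableSet_Ioc] with r hr using hr.1.le
  simp_rw [h3]
  rw [← ofReal_integral_eq_lintegral_ofReal, integral_div, ← integral_Ioc_eq_integral_Ioo,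
    ← intervalIntegral.integral_of_le (by linarith [Real.pi_pos])]
  · exact (((h.continuous_radius.pow 2).div_const 2).integrableOn_Icc).mono_set Ioo_subset_Icc_self
  · exact Filter.Eventually.of_forall fun θ => by positivity

theorem integral_radius_sq (hvol : volume Δ = 1) (a : ℝ) :
    ∫ θ in a..(a + 2 * Real.pi), radius Δ o θ ^ 2 = 2 := by
  have hp : Function.Periodic (fun θ => radius Δ o θ ^ 2) (2 * Real.pi) := fun θ => by
    simp only [radius_add_two_pi]
  rw [hp.intervalIntegral_add_eq a (-Real.pi), show -Real.pi + 2 * Real.pi = Real.pi by ring]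
  have h1 := h.volume_eq
  rw [hvol] at h1
  have := ENNReal.ofReal_eq_one.1 h1.symm
  linarith

/-! ### Boundary arcs -/

/-- Hahn–Banach separates `z` strictly from the interior; the weak inequality extends to `Δ`, which
lies in the closure of its interior. -/
theorem exists_supporting {z : ℝ × ℝ} (hz : z ∈ frontier Δ) :
    ∃ f : ℝ × ℝ →L[ℝ] ℝ, (∀ x ∈ interior Δ, f x < f z) ∧ ∀ x ∈ Δ, f x ≤ f z := by
  obtain ⟨f, hf⟩ := geometric_hahn_banach_open_point h.convex.interior isOpen_interior hz.2
  refine ⟨f, hf, fun x hx => ?_⟩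
  have hx' : x ∈ closure (interior Δ) := by
    rw [h.convex.closure_interior_eq_closure_of_nonempty_interior ⟨o, h.mem_interior⟩]
    exact subset_closure hx
  exact closure_minimal (fun y hy => (hf y hy).le) (isClosed_le f.continuous continuous_const) hx'

theorem segment_subset_interior {o' : ℝ × ℝ} (ho' : o' ∈ interior Δ) {s : ℝ} (hs : s ∈ Icc (0 : ℝ) 1) :
    o + s • (o' - o) ∈ interior Δ :=
  h.convex.interior.add_smul_sub_mem h.mem_interior ho' hs

end

theorem onRay_iff_toComplex {z : ℝ × ℝ} {θ : ℝ} :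
    OnRay o θ z ↔ ∃ r : ℝ, 0 < r ∧ toComplex (z - o) = r * Complex.exp (θ * Complex.I) := by
  rw [onRay_iff]
  refine exists_congr fun r => and_congr_right fun _ => ?_
  rw [Complex.exp_mul_I, ← toComplex_smul_dir, add_comm, ← sub_eq_iff_eq_add]
  exact (Complex.equivRealProdCLM.symm.injective.eq_iff).symm

/-- When the base point moves along a segment in the interior of `Δ`, the direction in which a
given boundary point is seen can be chosen continuously. -/
theorem exists_continuous_angle (h : IsPointedBody Δ o) {o' : ℝ × ℝ} (ho' : o' ∈ interior Δ)
    {z : ℝ × ℝ} (hz : z ∈ frontier Δ) {a : ℝ} (ha : OnRay o a z) :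
    ∃ A : ℝ → ℝ, ContinuousOn A (Icc 0 1) ∧ A 0 = a ∧
      ∀ s ∈ Icc (0 : ℝ) 1, OnRay (o + s • (o' - o)) (A s) z := by
  obtain ⟨f, hf, -⟩ := h.exists_supporting hz
  set w : ℝ → ℂ := fun s => toComplex (z - (o + s • (o' - o))) with hw
  have hwc : Continuous w := by
    apply contDiff_toComplex.continuous.comp
    fun_prop
  have hpos : ∀ s ∈ Icc (0 : ℝ) 1, 0 < f (Complex.equivRealProdCLM (w s)) := by
    intro s hs
    have := hf _ (h.segment_subset_interior ho' hs)
    simp only [hw, toComplex, ContinuousLinearEquiv.apply_symm_apply]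
    rw [map_sub]
    linarith
  have h0 : (0 : ℝ) ∈ Icc (0 : ℝ) 1 := ⟨le_rfl, zero_le_one⟩
  have hw0 : ∀ s ∈ Icc (0 : ℝ) 1, w s ≠ 0 := by
    intro s hs h0
    have := hpos s hs
    rw [h0, map_zero, map_zero] at this
    exact this.false
  -- All the vectors `w s` lie in the open half-plane where the supporting functional is positive,
  -- so no quotient `w s / w 0` is a nonpositive real and its argument is continuous in `s`.
  have hslit : ∀ s ∈ Icc (0 : ℝ) 1, w s / w 0 ∈ Complex.slitPlane := by
    intro s hs
    rw [Complex.mem_slitPlane_iff]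
    by_contra hcon
    push Not at hcon
    have h1 : w s = (w s / w 0).re • w 0 := by
      have e : w s / w 0 = ((w s / w 0).re : ℂ) := Complex.ext rfl (by simpa using hcon.2)
      rw [Complex.real_smul, ← e, div_mul_cancel₀ _ (hw0 0 h0)]
    have h2 := hpos s hs
    rw [h1, map_smul, map_smul, smul_eq_mul] at h2
    nlinarith [hpos 0 h0, hcon.1]
  refine ⟨fun s => a + Complex.arg (w s / w 0), ?_, ?_, ?_⟩
  · intro s hs
    apply ContinuousAt.continuousWithinAt
    refine continuousAt_const.add ?_
    exact ContinuousAt.comp (f := fun s => w s / w 0) (Complex.continuousAt_arg (hslit s hs))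
      (hwc.div_const _).continuousAt
  · simp [hw0 0 h0]
  · intro s hs
    rw [onRay_iff_toComplex] at ha ⊢
    obtain ⟨r, hr, hra⟩ := ha
    have hra' : w 0 = r * Complex.exp (a * Complex.I) := by simpa [hw] using hra
    refine ⟨r * ‖w s / w 0‖, mul_pos hr (norm_pos_iff.2 (div_ne_zero (hw0 s hs) (hw0 0 h0))), ?_⟩
    change w s = _
    have e := Complex.norm_mul_exp_arg_mul_I (w s / w 0)
    have hd : w s = w 0 * (w s / w 0) := (mul_div_cancel₀ _ (hw0 0 h0)).symm
    rw [Complex.ofReal_mul, Complex.ofReal_add, add_mul, Complex.exp_add]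
    linear_combination hd + (w s / w 0) * hra' - (r : ℂ) * Complex.exp (a * Complex.I) * e

theorem onRay_unique {z : ℝ × ℝ} {a b : ℝ} (ha : OnRay o a z) (hb : OnRay o b z) :
    ∃ n : ℤ, b = a + n * (2 * Real.pi) := by
  rw [onRay_iff_toComplex] at ha hb
  obtain ⟨r, hr, h1⟩ := ha
  obtain ⟨s, hs, h2⟩ := hb
  have h3 : ‖toComplex (z - o)‖ = r := by
    rw [h1, norm_mul, Complex.norm_exp_ofReal_mul_I, mul_one, Complex.norm_real,
      Real.norm_of_nonneg hr.le]
  have h4 : ‖toComplex (z - o)‖ = s := by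
    rw [h2, norm_mul, Complex.norm_exp_ofReal_mul_I, mul_one, Complex.norm_real,
      Real.norm_of_nonneg hs.le]
  rw [h1, ← h4, h3] at h2
  have h5 := mul_left_cancel₀ (Complex.ofReal_ne_zero.2 hr.ne') h2
  obtain ⟨n, hn⟩ := Complex.exp_eq_exp_iff_exists_int.1 h5.symm
  refine ⟨n, ?_⟩
  have h6 : (b : ℂ) = a + n * (2 * Real.pi) := by
    apply mul_right_cancel₀ Complex.I_ne_zero
    rw [hn]; ring
  exact_mod_cast h6

theorem eq_of_onRay_of_eq_add (h : IsPointedBody Δ o) {p q : ℝ × ℝ} {a b : ℝ}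
    (hp : p ∈ frontier Δ) (hq : q ∈ frontier Δ) (ha : OnRay o a p) (hb : OnRay o b q) {n : ℤ}
    (hab : b = a + n * (2 * Real.pi)) : p = q := by
  have hb' := ha.add_int_mul n
  rw [← hab] at hb'
  rw [h.eq_of_onRay hb hq, h.eq_of_onRay hb' hp]

/-- Whether one boundary point follows another counterclockwise within one turn does not depend on
the interior point from which they are seen. -/
theorem angle_sub_mem_Ioo (h : IsPointedBody Δ o) {o' : ℝ × ℝ} (ho' : o' ∈ interior Δ)
    {p q : ℝ × ℝ} (hp : p ∈ frontier Δ) (hq : q ∈ frontier Δ) (hpq : p ≠ q) {A B : ℝ → ℝ}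
    (hA : ContinuousOn A (Icc 0 1)) (hB : ContinuousOn B (Icc 0 1))
    (hAp : ∀ s ∈ Icc (0 : ℝ) 1, OnRay (o + s • (o' - o)) (A s) p)
    (hBq : ∀ s ∈ Icc (0 : ℝ) 1, OnRay (o + s • (o' - o)) (B s) q)
    (h0 : B 0 - A 0 ∈ Ioo 0 (2 * Real.pi)) : B 1 - A 1 ∈ Ioo 0 (2 * Real.pi) := by
  have hcont : ContinuousOn (fun s => B s - A s) (Icc 0 1) := hB.sub hA
  -- Distinct boundary points are never seen in the same direction, so the angle difference cannot
  -- cross `0` or `2π`.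
  have hne : ∀ n : ℤ, ∀ s ∈ Icc (0 : ℝ) 1, B s - A s ≠ n * (2 * Real.pi) := by
    intro n s hs hn
    have hs' : IsPointedBody Δ (o + s • (o' - o)) :=
      ⟨h.isCompact, h.convex, h.segment_subset_interior ho' hs⟩
    exact hpq (hs'.eq_of_onRay_of_eq_add hp hq (hAp s hs) (hBq s hs) (by linarith))
  constructor
  · by_contra hcon
    push Not at hcon
    obtain ⟨s, hs, hs0⟩ := intermediate_value_Icc' zero_le_one hcont ⟨hcon, h0.1.le⟩
    exact hne 0 s hs (by simpa using hs0)
  · by_contra hcon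
    push Not at hcon
    obtain ⟨s, hs, hs0⟩ := intermediate_value_Icc zero_le_one hcont ⟨h0.2.le, hcon⟩
    exact hne 1 s hs (by simpa using hs0)

/-- The points of a boundary arc seen from an arbitrary interior point. -/
theorem exists_onRay_of_mem_ccwArc (h : IsPointedBody Δ o) {p q z : ℝ × ℝ} (hp : p ∈ frontier Δ)
    (hq : q ∈ frontier Δ) {a b : ℝ} (ha : OnRay o a p) (hb : OnRay o b q) (hab : a < b)
    (hba : b ≤ a + 2 * Real.pi) (hz : z ∈ ccwArc Δ p q) : ∃ c, a ≤ c ∧ c ≤ b ∧ OnRay o c z := by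
  obtain ⟨hzf, o₀, ho₀, a₀, b₀, c₀, hac, hcb, hba₀, ha₀, hc₀, hb₀⟩ := hz
  have hpi := Real.pi_pos
  have h₀ : IsPointedBody Δ o₀ := ⟨h.isCompact, h.convex, ho₀⟩
  have key : ∀ {x y : ℝ}, x < y → y ≤ x + 2 * Real.pi → ∀ n : ℤ, y = x + n * (2 * Real.pi) →
      y = x + 2 * Real.pi := by
    intro x y hxy hyx n hn
    have h1 : (0 : ℝ) < n := by
      by_contra hcon
      push Not at hcon
      nlinarith
    have h3 : 0 < n := by exact_mod_cast h1
    have h2 : (1 : ℝ) ≤ n := by exact_mod_cast h3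
    nlinarith
  by_cases hzp : z = p
  · exact ⟨a, le_rfl, hab.le, hzp ▸ ha⟩
  by_cases hzq : z = q
  · exact ⟨b, hab.le, le_rfl, hzq ▸ hb⟩
  -- Here `a < b ≤ a + 2π` forces a full turn: the arc may be the whole boundary (as when `N = 1`),
  -- and any angle of `z` reduced into `[a, a + 2π)` will do.
  by_cases hpq : p = q
  · subst hpq
    obtain ⟨n, hn⟩ := onRay_unique ha hb
    have hb' := key hab hba n hn
    obtain ⟨c, hc⟩ := exists_onRay (h.ne_of_mem_frontier hzf)
    have hT : (0 : ℝ) < 2 * Real.pi := by positivity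
    have hm := toIcoMod_mem_Ico hT a c
    refine ⟨toIcoMod hT a c, hm.1, by rw [hb']; exact hm.2.le, ?_⟩
    rw [toIcoMod, sub_eq_add_neg, ← neg_smul, zsmul_eq_mul]
    exact hc.add_int_mul _
  have hlt : ∀ {x y : ℝ × ℝ} {u v : ℝ}, x ∈ frontier Δ → y ∈ frontier Δ → x ≠ y → OnRay o₀ u x →
      OnRay o₀ v y → ∀ n : ℤ, v - u ≠ n * (2 * Real.pi) := by
    intro x y u v hx hy hxy hu hv n hn
    exact hxy (h₀.eq_of_onRay_of_eq_add hx hy hu hv (n := n) (by linarith))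
  have hac' : c₀ - a₀ ≠ 0 := by simpa using hlt hp hzf (Ne.symm hzp) ha₀ hc₀ 0
  have hcb' : b₀ - c₀ ≠ 0 := by simpa using hlt hzf hq hzq hc₀ hb₀ 0
  have hab' : b₀ - a₀ ≠ 2 * Real.pi := by simpa using hlt hp hq hpq ha₀ hb₀ 1
  have i1 : 0 < c₀ - a₀ := lt_of_le_of_ne (by linarith) hac'.symm
  have i2 : 0 < b₀ - c₀ := lt_of_le_of_ne (by linarith) hcb'.symm
  have i3 : b₀ - a₀ < 2 * Real.pi := lt_of_le_of_ne (by linarith) hab'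
  -- The three angles are transported along the segment from `o₀` to `o`; the cyclic order of `p`,
  -- `z`, `q` survives.
  obtain ⟨A, hA, hA0, hA1⟩ := h₀.exists_continuous_angle h.mem_interior hp ha₀
  obtain ⟨B, hB, hB0, hB1⟩ := h₀.exists_continuous_angle h.mem_interior hq hb₀
  obtain ⟨C, hC, hC0, hC1⟩ := h₀.exists_continuous_angle h.mem_interior hzf hc₀
  have j1 := h₀.angle_sub_mem_Ioo h.mem_interior hp hzf (Ne.symm hzp) hA hC hA1 hC1
    (by rw [hA0, hC0]; constructor <;> linarith)
  have j2 := h₀.angle_sub_mem_Ioo h.mem_interior hzf hq hzq hC hB hC1 hB1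
    (by rw [hB0, hC0]; constructor <;> linarith)
  have j3 := h₀.angle_sub_mem_Ioo h.mem_interior hp hq hpq hA hB hA1 hB1
    (by rw [hA0, hB0]; constructor <;> linarith)
  have hone : (1 : ℝ) ∈ Icc (0 : ℝ) 1 := ⟨zero_le_one, le_rfl⟩
  have kA := hA1 1 hone
  have kB := hB1 1 hone
  have kC := hC1 1 hone
  rw [one_smul, add_sub_cancel] at kA kB kC
  obtain ⟨n, hn⟩ := onRay_unique kA ha
  obtain ⟨m, hm⟩ := onRay_unique (kB.add_int_mul n) hb
  have hb' : b < a + 2 * Real.pi := by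
    refine lt_of_le_of_ne hba fun hcon => hpq ?_
    exact h.eq_of_onRay_of_eq_add hp hq ha hb (n := 1) (by push_cast; linarith)
  have hm0 : m = 0 := by
    have e : b - a = B 1 - A 1 + m * (2 * Real.pi) := by rw [hm, hn]; ring
    have m1 : (m : ℝ) < 1 := by
      by_contra hcon
      push Not at hcon
      nlinarith [j3.1]
    have m2 : (-1 : ℝ) < m := by
      by_contra hcon
      push Not at hcon
      nlinarith [j3.2]
    have m1' : m < 1 := by exact_mod_cast m1
    have m2' : -1 < m := by exact_mod_cast m2
    omega
  refine ⟨C 1 + n * (2 * Real.pi), ?_, ?_, kC.add_int_mul n⟩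
  · linarith [j1.1]
  · rw [hm, hm0]
    push_cast
    linarith [j2.1]

end IsPointedBody

/-! ### One-sided smoothness of the radial function -/

theorem hasDerivAt_dir (θ : ℝ) : HasDerivAt dir (-Real.sin θ, Real.cos θ) θ :=
  (Real.hasDerivAt_cos θ).prodMk (Real.hasDerivAt_sin θ)

namespace IsPointedBody

variable {Δ : Set (ℝ × ℝ)} {o : ℝ × ℝ}

/-- A smooth boundary of a convex body is transverse to the rays from an interior point. -/
theorem radial_transversality (h : IsPointedBody Δ o) {θ : ℝ} {U : Set (ℝ × ℝ)} {f : ℝ × ℝ → ℝ}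
    (hU : IsOpen U) (hzU : o + radius Δ o θ • dir θ ∈ U) (hf : ContDiffOn ℝ ∞ f U)
    (hdf : fderiv ℝ f (o + radius Δ o θ • dir θ) ≠ 0) (hfr : ∀ w ∈ U, w ∈ frontier Δ ↔ f w = 0) :
    fderiv ℝ f (o + radius Δ o θ • dir θ) (dir θ) ≠ 0 := by
  set ρ := radius Δ o θ with hρ
  set z := o + ρ • dir θ with hz
  set L := fderiv ℝ f z with hL
  set n : ℝ × ℝ := (-Real.sin θ, Real.cos θ) with hn
  have hρ0 : 0 < ρ := h.radius_pos θ
  -- If the ray were tangent to the boundary at `z`, there would be boundary points `w = z + x •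
  -- (dir θ + t • n)` beyond `z` with `|t| ≤ c`. Then `z` lies on the open segment from `w` to `o -
  -- (ρ * t) • n`, which is interior for small `c`, so `z` would be interior.
  intro hLe
  have hz0 : f z = 0 := (hfr z hzU).1 (h.radius_smul_dir_mem_frontier θ)
  have hLn : L n ≠ 0 := by
    intro hLn
    apply hdf
    ext
    · have e : ((1 : ℝ), (0 : ℝ)) = Real.cos θ • dir θ - Real.sin θ • n := by
        ext
        · simp [dir, hn, ← sq]
        · simp [dir, hn]; ring
      have : L (1, 0) = 0 := by rw [e, map_sub, map_smul, map_smul, hLe, hLn]; simp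
      simpa using this
    · have e : ((0 : ℝ), (1 : ℝ)) = Real.sin θ • dir θ + Real.cos θ • n := by
        ext
        · simp [dir, hn]; ring
        · simp [dir, hn, ← sq]
      have : L (0, 1) = 0 := by rw [e, map_add, map_smul, map_smul, hLe, hLn]; simp
      simpa using this
  have hnorm : ‖dir θ‖ ≤ 1 ∧ ‖n‖ ≤ 1 := by
    simp only [dir, hn, norm_prod_le_iff, norm_neg, Real.norm_eq_abs, Real.abs_cos_le_one,
      Real.abs_sin_le_one, and_self]
  obtain ⟨ε, hε, hball⟩ := Metric.isOpen_iff.1 isOpen_interior o h.mem_interior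
  obtain ⟨c, hc, hcε⟩ : ∃ c : ℝ, 0 < c ∧ ρ * c < ε := by
    refine ⟨ε / (2 * ρ), by positivity, ?_⟩
    field_simp
    linarith
  have hder : HasFDerivAt f L z :=
    ((hf.contDiffAt (hU.mem_nhds hzU)).differentiableAt (by simp)).hasFDerivAt
  have hlo := hder.isLittleO
  rw [Asymptotics.isLittleO_iff] at hlo
  have hη : 0 < c * |L n| / (2 * (1 + c)) := by positivity
  have hev := (hlo hη).and (hU.mem_nhds hzU)
  obtain ⟨δ, hδ, hδ'⟩ := Metric.eventually_nhds_iff.1 hev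
  set x := δ / (2 * (1 + c)) with hx
  have hx0 : 0 < x := by positivity
  have hv : ∀ t ∈ Icc (-c) c, ‖x • (dir θ + t • n)‖ ≤ x * (1 + c) := by
    intro t ht
    rw [norm_smul, Real.norm_of_nonneg hx0.le]
    gcongr
    calc ‖dir θ + t • n‖ ≤ ‖dir θ‖ + ‖t • n‖ := norm_add_le _ _
      _ ≤ 1 + c * 1 := by
        rw [norm_smul]
        gcongr
        · exact hnorm.1
        · exact abs_le.2 ⟨ht.1, ht.2⟩
        · exact hnorm.2
      _ = 1 + c := by ring
  have hclose : ∀ t ∈ Icc (-c) c, |f (z + x • (dir θ + t • n)) - x * t * L n| ≤ c * |L n| * x / 2 ∧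
      z + x • (dir θ + t • n) ∈ U := by
    intro t ht
    have hd : dist (z + x • (dir θ + t • n)) z < δ := by
      rw [dist_eq_norm, add_sub_cancel_left]
      refine (hv t ht).trans_lt ?_
      rw [hx]; field_simp; linarith
    obtain ⟨e1, e2⟩ := hδ' hd
    refine ⟨?_, e2⟩
    rw [add_sub_cancel_left, hz0, map_smul, map_add, map_smul, hLe, sub_zero, zero_add,
      smul_eq_mul, smul_eq_mul, ← mul_assoc, Real.norm_eq_abs] at e1
    refine e1.trans ?_
    calc _ ≤ c * |L n| / (2 * (1 + c)) * (x * (1 + c)) := by gcongr; exact hv t ht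
      _ = _ := by field_simp
  have hcont : ContinuousOn (fun t => f (z + x • (dir θ + t • n))) (Icc (-c) c) :=
    hf.continuousOn.comp (by fun_prop) fun t ht => (hclose t ht).2
  have hcc : -c ≤ c := by linarith
  -- To first order `f` equals `x * t * L n`; the error is at most half of its size at `t = ±c`, so
  -- `f` changes sign.
  obtain ⟨t, ht, ht0⟩ : ∃ t ∈ Icc (-c) c, f (z + x • (dir θ + t • n)) = 0 := by
    have e1 := abs_le.1 (hclose (-c) (left_mem_Icc.2 hcc)).1
    have e2 := abs_le.1 (hclose c (right_mem_Icc.2 hcc)).1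
    rcases lt_or_gt_of_ne hLn with hneg | hpos
    · rw [abs_of_neg hneg] at e1 e2
      have : 0 < c * x * -(L n) := by have := neg_pos.2 hneg; positivity
      exact intermediate_value_Icc' hcc hcont ⟨by nlinarith, by nlinarith⟩
    · rw [abs_of_pos hpos] at e1 e2
      have : 0 < c * x * (L n) := by positivity
      exact intermediate_value_Icc hcc hcont ⟨by nlinarith, by nlinarith⟩
  have hw : z + x • (dir θ + t • n) ∈ Δ :=
    h.isCompact.isClosed.frontier_subset ((hfr _ (hclose t ht).2).2 ht0)
  have ho' : o - (ρ * t) • n ∈ interior Δ := by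
    apply hball
    rw [Metric.mem_ball, dist_eq_norm, sub_sub_cancel_left, norm_neg, norm_smul, Real.norm_eq_abs,
      abs_mul, abs_of_pos hρ0]
    refine lt_of_le_of_lt ?_ hcε
    calc ρ * |t| * ‖n‖ ≤ ρ * c * 1 := by
          gcongr
          · exact abs_le.2 ⟨ht.1, ht.2⟩
          · exact hnorm.2
      _ = ρ * c := mul_one _
  have hρx : 0 < ρ + x := by positivity
  have hcombo := h.convex.combo_interior_self_mem_interior ho' hw
    (a := x / (ρ + x)) (b := ρ / (ρ + x)) (by positivity) (by positivity)
    (by field_simp; ring)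
  have : (x / (ρ + x)) • (o - (ρ * t) • n) + (ρ / (ρ + x)) • (z + x • (dir θ + t • n)) = z := by
    rw [hz]
    ext <;> simp <;> field_simp <;> ring
  rw [this] at hcombo
  exact (h.radius_smul_dir_mem_frontier θ).2 hcombo

/-- Transversality allows the implicit function theorem to solve `f (o + r • dir θ) = 0` for `r`. By
continuity the radial function stays where the solution is unique, hence equals it. -/
theorem contDiff_radius (h : IsPointedBody Δ o) (hs : HasSmoothBoundary Δ) :
    ContDiff ℝ ∞ (radius Δ o) := by
  rw [contDiff_iff_contDiffAt]
  intro θ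
  obtain ⟨U, f, hU, hzU, hf, hdf, hfr⟩ := hs _ (h.radius_smul_dir_mem_frontier θ)
  have htr := h.radial_transversality hU hzU hf hdf hfr
  set u : ℝ × ℝ := (θ, radius Δ o θ) with hu
  have hP : ContDiff ℝ ∞ fun p : ℝ × ℝ => o + p.2 • dir p.1 :=
    contDiff_const.add (contDiff_snd.smul (contDiff_dir.comp contDiff_fst))
  have hfz : ContDiffAt ℝ ∞ f (o + radius Δ o θ • dir θ) := hf.contDiffAt (hU.mem_nhds hzU)
  have cdf : ContDiffAt ℝ ∞ (fun p : ℝ × ℝ => f (o + p.2 • dir p.1)) u :=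
    ContDiffAt.comp u (g := f) hfz hP.contDiffAt
  have hder : fderiv ℝ (fun p : ℝ × ℝ => f (o + p.2 • dir p.1)) u (0, 1) =
      fderiv ℝ f (o + radius Δ o θ • dir θ) (dir θ) := by
    have h1 : HasFDerivAt (fun p : ℝ × ℝ => f (o + p.2 • dir p.1)) _ u :=
      HasFDerivAt.comp u (g := f) (hfz.differentiableAt (by simp)).hasFDerivAt
        (hP.differentiable (by simp) u).hasFDerivAt
    have hd : HasFDerivAt (fun p : ℝ × ℝ => dir p.1) _ u :=
      HasFDerivAt.comp u (g := dir) (hasDerivAt_dir θ).hasFDerivAt hasFDerivAt_fst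
    have h2 : HasFDerivAt (fun p : ℝ × ℝ => o + p.2 • dir p.1) _ u :=
      (HasFDerivAt.smul (c := fun p : ℝ × ℝ => p.2) hasFDerivAt_snd hd).const_add o
    rw [h1.fderiv, h2.fderiv]
    simp [hu]
  have inv : (fderiv ℝ (fun p : ℝ × ℝ => f (o + p.2 • dir p.1)) u ∘L
      .inr ℝ ℝ ℝ).IsInvertible := by
    refine ⟨ContinuousLinearEquiv.unitsEquivAut ℝ (Units.mk0 _ htr), ?_⟩
    ext
    simp [hder]
  have hne : (∞ : WithTop ℕ∞) ≠ 0 := by simp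
  have hiff := cdf.eventually_apply_eq_iff_implicitFunction hne inv
  refine (cdf.contDiffAt_implicitFunction hne inv).congr_of_eventuallyEq ?_
  have hc : Continuous fun t => (t, radius Δ o t) := continuous_id.prodMk h.continuous_radius
  have hcz : Continuous fun t => o + radius Δ o t • dir t := hP.continuous.comp hc
  filter_upwards [hc.continuousAt.eventually hiff, hcz.continuousAt.eventually (hU.mem_nhds hzU)]
    with t ht htU
  refine (ht.1 ?_).symm
  have e1 := (hfr _ htU).1 (h.radius_smul_dir_mem_frontier t)
  have e2 := (hfr _ hzU).1 (h.radius_smul_dir_mem_frontier θ)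
  exact e1.trans e2.symm

/-- The radial function is smooth over a straight piece of the boundary. -/
theorem contDiffOn_radius_of_segment (h : IsPointedBody Δ o) {a b : ℝ} (hab : a < b)
    (hba : b < a + Real.pi) (hseg : segment ℝ (o + radius Δ o a • dir a) (o + radius Δ o b • dir b) ⊆ frontier Δ) :
    ContDiffOn ℝ ∞ (radius Δ o) (Icc a b) := by
  set ρa := radius Δ o a
  set ρb := radius Δ o b
  have ha0 : 0 < ρa := h.radius_pos a
  have hb0 : 0 < ρb := h.radius_pos b
  have hsab : 0 < Real.sin (b - a) := Real.sin_pos_of_pos_of_lt_pi (by linarith) (by linarith)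
  have hD : ∀ t ∈ Icc a b, 0 ≤ Real.sin (b - t) ∧ 0 ≤ Real.sin (t - a) ∧
      0 < ρb * Real.sin (b - t) + ρa * Real.sin (t - a) := by
    intro t ht
    have h1 : 0 ≤ Real.sin (b - t) :=
      Real.sin_nonneg_of_nonneg_of_le_pi (by linarith [ht.2]) (by linarith [ht.1])
    have h2 : 0 ≤ Real.sin (t - a) :=
      Real.sin_nonneg_of_nonneg_of_le_pi (by linarith [ht.1]) (by linarith [ht.2])
    refine ⟨h1, h2, ?_⟩
    rcases ht.1.eq_or_lt with rfl | hlt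
    · simpa using mul_pos hb0 hsab
    · have : 0 < Real.sin (t - a) :=
        Real.sin_pos_of_pos_of_lt_pi (by linarith) (by linarith [ht.2])
      positivity
  -- This is the polar equation of the line through the two boundary points.
  have hg : ContDiffOn ℝ ∞ (fun t => ρa * ρb * Real.sin (b - a) /
      (ρb * Real.sin (b - t) + ρa * Real.sin (t - a))) (Icc a b) := by
    apply ContDiffOn.div
    · fun_prop
    · apply ContDiff.contDiffOn
      apply ContDiff.add
      · exact contDiff_const.mul (Real.contDiff_sin.comp (contDiff_const.sub contDiff_id))
      · exact contDiff_const.mul (Real.contDiff_sin.comp (contDiff_id.sub contDiff_const))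
    · exact fun t ht => (hD t ht).2.2.ne'
  refine hg.congr fun t ht => ?_
  obtain ⟨h1, h2, h3⟩ := hD t ht
  symm
  rw [← h.mem_frontier_iff (by positivity)]
  apply hseg
  set D := ρb * Real.sin (b - t) + ρa * Real.sin (t - a)
  refine ⟨ρb * Real.sin (b - t) / D, ρa * Real.sin (t - a) / D, by positivity, by positivity,
    by rw [← add_div, div_self h3.ne'], ?_⟩
  have hc : Real.sin (b - a) * Real.cos t =
      Real.sin (b - t) * Real.cos a + Real.sin (t - a) * Real.cos b := by
    rw [Real.sin_sub, Real.sin_sub, Real.sin_sub]; ring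
  have hs : Real.sin (b - a) * Real.sin t =
      Real.sin (b - t) * Real.sin a + Real.sin (t - a) * Real.sin b := by
    rw [Real.sin_sub, Real.sin_sub, Real.sin_sub]; ring
  ext
  · simp only [dir, Prod.fst_add, Prod.smul_fst, smul_eq_mul]
    field_simp
    simp only [D]
    linear_combination (-(ρa * ρb)) * hc
  · simp only [dir, Prod.snd_add, Prod.smul_snd, smul_eq_mul]
    field_simp
    simp only [D]
    linear_combination (-(ρa * ρb)) * hs

/-- The boundary points of a polygon lie in one of finitely many convex pieces of the boundary. -/
theorem exists_subset_convexHull_of_polygon (h : IsPointedBody Δ o) {V : Finset (ℝ × ℝ)}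
    (hV : Δ = convexHull ℝ (V : Set (ℝ × ℝ))) {z : ℝ × ℝ} (hz : z ∈ frontier Δ) :
    ∃ W ⊆ (V : Set (ℝ × ℝ)), z ∈ convexHull ℝ W ∧ convexHull ℝ W ⊆ frontier Δ := by
  obtain ⟨f, hf, hf'⟩ := h.exists_supporting hz
  have hzΔ : z ∈ Δ := h.isCompact.isClosed.frontier_subset hz
  -- The face exposed by a supporting functional at `z` misses the interior and is the convex hull
  -- of its extreme points, all of which belong to `V`.
  set F := {x ∈ Δ | ∀ y ∈ Δ, f y ≤ f x} with hF
  have hFe : IsExposed ℝ Δ F := fun _ => ⟨f, rfl⟩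
  have hFc : IsCompact F := hFe.isCompact h.isCompact
  have hFconv : Convex ℝ F := hFe.convex h.convex
  have hW : F.extremePoints ℝ ⊆ (V : Set (ℝ × ℝ)) := by
    refine hFe.isExtreme.extremePoints_subset_extremePoints.trans ?_
    rw [hV]
    exact extremePoints_convexHull_subset
  have hfin : (F.extremePoints ℝ).Finite := V.finite_toSet.subset hW
  have hFW : convexHull ℝ (F.extremePoints ℝ) = F :=
    (hfin.isClosed_convexHull ℝ).closure_eq.symm.trans
      (closure_convexHull_extremePoints hFc hFconv)
  refine ⟨_, hW, ?_, ?_⟩ <;> rw [hFW]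
  · exact ⟨hzΔ, hf'⟩
  · intro x hx
    rw [h.isCompact.isClosed.frontier_eq]
    exact ⟨hx.1, fun hxi => absurd (hx.2 z hzΔ) (not_le.2 (hf x hxi))⟩

/-- By finiteness one convex boundary piece is met frequently along `l`. Being closed it also
contains the point in direction `θ`, and being convex it contains the segment. -/
theorem exists_segment_subset_frontier (h : IsPointedBody Δ o) (hs : IsConvexPolygon Δ)
    {θ : ℝ} {l : Filter ℝ} [l.NeBot] (hl : l ≤ nhds θ) {P : ℝ → Prop} (hP : ∀ᶠ t in l, P t) :
    ∃ t, P t ∧ segment ℝ (o + radius Δ o θ • dir θ) (o + radius Δ o t • dir t) ⊆ frontier Δ := by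
  obtain ⟨V, hV⟩ := hs
  set z : ℝ → ℝ × ℝ := fun t => o + radius Δ o t • dir t with hz
  have hzc : Continuous z :=
    continuous_const.add (h.continuous_radius.smul contDiff_dir.continuous)
  obtain ⟨W, hWV, hWf, hW⟩ : ∃ W ⊆ (V : Set (ℝ × ℝ)), convexHull ℝ W ⊆ frontier Δ ∧
      ∃ᶠ t in l, z t ∈ convexHull ℝ W := by
    by_contra hcon
    push Not at hcon
    have hfin : {W | W ⊆ (V : Set (ℝ × ℝ))}.Finite := V.finite_toSet.finite_subsets
    have hall : ∀ᶠ t in l, ∀ W ∈ {W | W ⊆ (V : Set (ℝ × ℝ))}, convexHull ℝ W ⊆ frontier Δ →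
        z t ∉ convexHull ℝ W := by
      rw [Filter.eventually_all_finite hfin]
      intro W hW
      by_cases hWf : convexHull ℝ W ⊆ frontier Δ
      · filter_upwards [hcon W hW hWf] with t ht _ using ht
      · exact Filter.Eventually.of_forall fun t hh => absurd hh hWf
    obtain ⟨t, ht⟩ := hall.exists
    obtain ⟨W, hW1, hW2, hW3⟩ :=
      h.exists_subset_convexHull_of_polygon hV (h.radius_smul_dir_mem_frontier t)
    exact ht W hW1 hW3 hW2
  have hcl : IsClosed (convexHull ℝ W) := (V.finite_toSet.subset hWV).isClosed_convexHull ℝ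
  have hθ : z θ ∈ convexHull ℝ W :=
    hcl.mem_of_frequently_of_tendsto hW (hzc.continuousAt.tendsto.mono_left hl)
  obtain ⟨t, ht, htP⟩ := (hW.and_eventually hP).exists
  exact ⟨t, htP, ((convex_convexHull ℝ W).segment_subset hθ ht).trans hWf⟩

/-- If the boundary is smooth or polygonal, the radial function is smooth on both sides of every
direction. -/
theorem exists_contDiffOn_radius (h : IsPointedBody Δ o)
    (hs : HasSmoothBoundary Δ ∨ IsConvexPolygon Δ) (θ : ℝ) :
    ∃ δ > 0, ContDiffOn ℝ ∞ (radius Δ o) (Icc θ (θ + δ)) ∧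
      ContDiffOn ℝ ∞ (radius Δ o) (Icc (θ - δ) θ) := by
  rcases hs with hs | hs
  · exact ⟨1, one_pos, (h.contDiff_radius hs).contDiffOn, (h.contDiff_radius hs).contDiffOn⟩
  · obtain ⟨t, ⟨ht1, ht2⟩, ht⟩ := h.exists_segment_subset_frontier hs (θ := θ)
      (l := nhdsWithin θ (Ioi θ)) nhdsWithin_le_nhds
      (Ioo_mem_nhdsGT (show θ < θ + Real.pi by linarith [Real.pi_pos]))
    obtain ⟨s, ⟨hs1, hs2⟩, hs⟩ := h.exists_segment_subset_frontier hs (θ := θ)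
      (l := nhdsWithin θ (Iio θ)) nhdsWithin_le_nhds
      (Ioo_mem_nhdsLT (show θ - Real.pi < θ by linarith [Real.pi_pos]))
    rw [segment_symm] at hs
    have k1 := h.contDiffOn_radius_of_segment ht1 ht2 ht
    have k2 := h.contDiffOn_radius_of_segment hs2 (by linarith) hs
    refine ⟨min (t - θ) (θ - s), lt_min (by linarith) (by linarith), k1.mono ?_, k2.mono ?_⟩
    · exact Icc_subset_Icc_right (by linarith [min_le_left (t - θ) (θ - s)])
    · exact Icc_subset_Icc_left (by linarith [min_le_right (t - θ) (θ - s)])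

end IsPointedBody

/-! ### Smooth parametrization of the boundary with almost constant areal speed -/

theorem deriv_eq_zero_of_eq_right {f : ℝ → ℝ} {a x : ℝ} (hf : Differentiable ℝ f)
    (h : ∀ t, x ≤ t → f t = a) : deriv f x = 0 := by
  have h1 := (hf x).hasDerivAt.hasDerivWithinAt (s := Ici x)
  have h2 : HasDerivWithinAt f 0 (Ici x) x :=
    (hasDerivWithinAt_const x (Ici x) a).congr (fun t ht => h t ht) (h x le_rfl)
  exact (uniqueDiffOn_Ici x x self_mem_Ici).eq_deriv _ h1 h2

theorem deriv_eq_zero_of_eq_left {f : ℝ → ℝ} {a x : ℝ} (hf : Differentiable ℝ f)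
    (h : ∀ t, t ≤ x → f t = a) : deriv f x = 0 := by
  have h1 := (hf x).hasDerivAt.hasDerivWithinAt (s := Iic x)
  have h2 : HasDerivWithinAt f 0 (Iic x) x :=
    (hasDerivWithinAt_const x (Iic x) a).congr (fun t ht => h t ht) (h x le_rfl)
  exact (uniqueDiffOn_Iic x x self_mem_Iic).eq_deriv _ h1 h2

/-- There is a smooth monotone reparametrization of `[a, b]`, stationary at the ends, along which
`ρ` is smooth and `ρ ^ 2` is swept out with speed at most `c` in time `∫ ρ ^ 2`. -/
def HasProfile (ρ : ℝ → ℝ) (c a b : ℝ) : Prop :=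
  ∃ α : ℝ → ℝ, ContDiff ℝ ∞ α ∧ Monotone α ∧ (∀ t ≤ 0, α t = a) ∧
    (∀ t, ∫ θ in a..b, ρ θ ^ 2 ≤ t → α t = b) ∧ ContDiff ℝ ∞ (fun t => ρ (α t)) ∧
    ∀ t, ρ (α t) ^ 2 * deriv α t ≤ c

theorem HasProfile.refl {ρ : ℝ → ℝ} {c : ℝ} (hc : 0 ≤ c) (a : ℝ) : HasProfile ρ c a a :=
  ⟨fun _ => a, contDiff_const, monotone_const, fun _ _ => rfl, fun _ _ => rfl, contDiff_const,
    by simpa using hc⟩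

/-- Take `α t + β (t - A) - y`. At each time one of the two profiles rests at `y`, so `ρ` of the sum
splits additively, hence smoothly even if `ρ` has a corner at `y`, and only one speed counts. -/
theorem HasProfile.trans {ρ : ℝ → ℝ} {c x y z : ℝ} (hρ : Continuous ρ) (hxy : x ≤ y) (hyz : y ≤ z)
    (h₁ : HasProfile ρ c x y) (h₂ : HasProfile ρ c y z) : HasProfile ρ c x z := by
  obtain ⟨α, hα, hαm, hα0, hα1, hρα, hαc⟩ := h₁
  obtain ⟨β, hβ, hβm, hβ0, hβ1, hρβ, hβc⟩ := h₂
  have hint : ∀ a b, IntervalIntegrable (fun θ => ρ θ ^ 2) volume a b := fun a b =>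
    (hρ.pow 2).intervalIntegrable a b
  have hadd := intervalIntegral.integral_add_adjacent_intervals (hint x y) (hint y z)
  have hA : 0 ≤ ∫ θ in x..y, ρ θ ^ 2 :=
    intervalIntegral.integral_nonneg hxy fun _ _ => sq_nonneg _
  have hB : 0 ≤ ∫ θ in y..z, ρ θ ^ 2 :=
    intervalIntegral.integral_nonneg hyz fun _ _ => sq_nonneg _
  set A := ∫ θ in x..y, ρ θ ^ 2
  have hcase : ∀ t, (t ≤ A ∧ β (t - A) = y) ∨ (A ≤ t ∧ α t = y) := by
    intro t
    rcases le_total t A with h | h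
    · exact Or.inl ⟨h, hβ0 _ (by linarith)⟩
    · exact Or.inr ⟨h, hα1 t h⟩
  have hβs : ContDiff ℝ ∞ fun t => β (t - A) := hβ.comp (contDiff_id.sub contDiff_const)
  have hd : ∀ t, deriv (fun t => α t + β (t - A) - y) t = deriv α t + deriv β (t - A) := by
    intro t
    have e1 := (hα.differentiable (by simp) t).hasDerivAt
    have e2 := ((hβ.differentiable (by simp) (t - A)).hasDerivAt).comp_sub_const t A
    exact ((e1.add e2).sub_const y).deriv
  refine ⟨fun t => α t + β (t - A) - y, (hα.add hβs).sub contDiff_const, ?_, ?_, ?_, ?_, ?_⟩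
  · intro s t hst
    have e1 := hαm hst
    have e2 := hβm (sub_le_sub_right hst A)
    simp only
    linarith
  · intro t ht
    simp only
    rw [hα0 t ht, hβ0 (t - A) (by linarith)]
    ring
  · intro t ht
    simp only
    rw [hα1 t (by linarith), hβ1 (t - A) (by linarith)]
    ring
  · have : (fun t => ρ (α t + β (t - A) - y)) = fun t => ρ (α t) + ρ (β (t - A)) - ρ y := by
      funext t
      rcases hcase t with ⟨-, h⟩ | ⟨-, h⟩
      · rw [h]; ring_nf
      · rw [h]; ring_nf
    rw [this]
    exact (hρα.add (hρβ.comp (contDiff_id.sub contDiff_const))).sub contDiff_const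
  · intro t
    simp only [hd]
    rcases hcase t with ⟨ht, h⟩ | ⟨ht, h⟩
    · have : deriv β (t - A) = 0 := deriv_eq_zero_of_eq_left (hβ.differentiable (by simp))
        (fun s hs => hβ0 s (by linarith))
      rw [h, this]
      simpa using hαc t
    · have : deriv α t = 0 := deriv_eq_zero_of_eq_right (hα.differentiable (by simp))
        (fun s hs => hα1 s (by linarith))
      rw [h, this]
      simpa using hβc (t - A)

/-- Use `a + (b - a) * S (t / A)`. Small oscillation gives `(b - a) * ρ² ≤ c * A`, and the slope of
`S` contributes the second factor `c`. -/
theorem HasProfile.of_contDiffOn {ρ : ℝ → ℝ} {c a b : ℝ} (hc : 1 < c) (hab : a ≤ b)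
    (hρ : Continuous ρ) (hρ0 : ∀ t, 0 < ρ t) (hs : ContDiffOn ℝ ∞ ρ (Icc a b))
    (hosc : ∀ s ∈ Icc a b, ∀ t ∈ Icc a b, ρ s ^ 2 ≤ c * ρ t ^ 2) : HasProfile ρ (c ^ 2) a b := by
  rcases hab.eq_or_lt with rfl | hlt
  · exact HasProfile.refl (by positivity) a
  obtain ⟨S, hS, hSm, hSc, v, hv, hS0, hS1⟩ := exists_smooth_step hc
  set A := ∫ θ in a..b, ρ θ ^ 2 with hA
  have hAle : ∀ s ∈ Icc a b, (b - a) * ρ s ^ 2 ≤ c * A := by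
    intro s hs
    have h1 : ∫ θ in a..b, ρ s ^ 2 ≤ ∫ θ in a..b, c * ρ θ ^ 2 :=
      intervalIntegral.integral_mono_on hab (by simp)
        ((continuous_const.mul (hρ.pow 2)).intervalIntegrable _ _) (fun t ht => hosc s hs t ht)
    rwa [intervalIntegral.integral_const, intervalIntegral.integral_const_mul, smul_eq_mul] at h1
  have hA0 : 0 < A := by
    have h1 := hAle a (left_mem_Icc.2 hab)
    have h2 : 0 < (b - a) * ρ a ^ 2 := mul_pos (by linarith) (pow_pos (hρ0 a) 2)
    by_contra hcon
    push Not at hcon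
    nlinarith
  have hS01 : ∀ t, S t ∈ Icc (0 : ℝ) 1 := by
    intro t
    constructor
    · rw [← hS0 (min t v) (min_le_right _ _)]
      exact hSm (min_le_left _ _)
    · rw [← hS1 (max t 1) (by linarith [le_max_right t 1])]
      exact hSm (le_max_left _ _)
  have hmem : ∀ t, a + (b - a) * S (t / A) ∈ Icc a b := by
    intro t
    obtain ⟨h1, h2⟩ := hS01 (t / A)
    constructor <;> nlinarith
  have hα : ContDiff ℝ ∞ fun t => a + (b - a) * S (t / A) :=
    contDiff_const.add (contDiff_const.mul (hS.comp (contDiff_id.div_const A)))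
  refine ⟨fun t => a + (b - a) * S (t / A), hα, ?_, ?_, ?_, ?_, ?_⟩
  · intro s t hst
    have : S (s / A) ≤ S (t / A) := hSm (by gcongr)
    simp only
    nlinarith
  · intro t ht
    simp [hS0 (t / A) ((div_nonpos_of_nonpos_of_nonneg ht hA0.le).trans hv.le)]
  · intro t ht
    have : 1 ≤ t / A := by rwa [one_le_div hA0]
    simp [hS1 (t / A) (by linarith)]
  · rw [← contDiffOn_univ]
    exact hs.comp (contDiffOn_univ.2 hα) fun t _ => hmem t
  · intro t
    have hd : deriv (fun t => a + (b - a) * S (t / A)) t = (b - a) * (deriv S (t / A) * (1 / A)) := by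
      have e1 := (hS.differentiable (by simp) (t / A)).hasDerivAt
      exact (((e1.comp t ((hasDerivAt_id t).div_const A)).const_mul (b - a)).const_add a).deriv
    simp only [hd]
    have hb := hAle _ (hmem t)
    have hS' := hSc (t / A)
    have hS'0 : 0 ≤ deriv S (t / A) := hSm.deriv_nonneg
    set R := ρ (a + (b - a) * S (t / A)) ^ 2
    calc R * ((b - a) * (deriv S (t / A) * (1 / A)))
        = ((b - a) * R) * deriv S (t / A) / A := by ring
      _ ≤ (c * A) * c / A := by gcongr
      _ = c ^ 2 := by field_simp

/-- Continuity keeps the oscillation of `ρ²` within the factor `c` near `θ`; an interval that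
straddles `θ` is cut there and the two profiles are concatenated. -/
theorem exists_hasProfile_of_sides {ρ : ℝ → ℝ} {c : ℝ} (hc : 1 < c)
    (hρ : Continuous ρ) (hρ0 : ∀ t, 0 < ρ t) {θ : ℝ}
    (hs : ∃ δ > 0, ContDiffOn ℝ ∞ ρ (Icc θ (θ + δ)) ∧ ContDiffOn ℝ ∞ ρ (Icc (θ - δ) θ)) :
    ∃ δ > 0, ∀ a b, a ≤ b → θ - δ ≤ a → b ≤ θ + δ → HasProfile ρ (c ^ 2) a b := by
  obtain ⟨δ, hδ, hr, hl⟩ := hs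
  have hcont : ContinuousAt (fun p : ℝ × ℝ => c * ρ p.2 ^ 2 - ρ p.1 ^ 2) (θ, θ) := by
    apply Continuous.continuousAt
    fun_prop
  have hpos : ∀ᶠ p in nhds (θ, θ), 0 < c * ρ p.2 ^ 2 - ρ p.1 ^ 2 := by
    apply hcont.eventually_const_lt
    have := pow_pos (hρ0 θ) 2
    simp only
    nlinarith
  obtain ⟨η, hη, hη'⟩ := Metric.eventually_nhds_iff.1 hpos
  have hosc : ∀ s t, |s - θ| < η → |t - θ| < η → ρ s ^ 2 ≤ c * ρ t ^ 2 := by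
    intro s t h1 h2
    have := @hη' (s, t) (by rw [Prod.dist_eq]; exact max_lt h1 h2)
    simp only at this
    linarith
  have hm1 : min δ (η / 2) ≤ δ := min_le_left _ _
  have hm2 : min δ (η / 2) ≤ η / 2 := min_le_right _ _
  refine ⟨min δ (η / 2), by positivity, ?_⟩
  have hR : ∀ a b, a ≤ b → θ ≤ a → b ≤ θ + min δ (η / 2) → HasProfile ρ (c ^ 2) a b := by
    intro a b hab ha hb
    refine HasProfile.of_contDiffOn hc hab hρ hρ0 (hr.mono (Icc_subset_Icc ha (by linarith))) ?_
    rintro s ⟨s1, s2⟩ t ⟨t1, t2⟩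
    apply hosc <;> rw [abs_lt] <;> constructor <;> linarith
  have hL : ∀ a b, a ≤ b → θ - min δ (η / 2) ≤ a → b ≤ θ → HasProfile ρ (c ^ 2) a b := by
    intro a b hab ha hb
    refine HasProfile.of_contDiffOn hc hab hρ hρ0 (hl.mono (Icc_subset_Icc (by linarith) hb)) ?_
    rintro s ⟨s1, s2⟩ t ⟨t1, t2⟩
    apply hosc <;> rw [abs_lt] <;> constructor <;> linarith
  intro a b hab ha hb
  rcases le_total θ a with h | h
  · exact hR a b hab h hb
  rcases le_total b θ with h' | h'
  · exact hL a b hab ha h'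
  · exact (hL a θ h ha le_rfl).trans hρ h h' (hR θ b h' le_rfl hb)

/-- Steps of half a Lebesgue number are concatenated; concatenation does not worsen the constant. -/
theorem hasProfile_of_local {ρ : ℝ → ℝ} {c : ℝ} (hc : 0 ≤ c) (hρ : Continuous ρ)
    (hloc : ∀ θ, ∃ δ > 0, ∀ a b, a ≤ b → θ - δ ≤ a → b ≤ θ + δ → HasProfile ρ c a b)
    {a b : ℝ} (hab : a ≤ b) : HasProfile ρ c a b := by
  choose δ hδ hP using hloc
  obtain ⟨η, hη, hη'⟩ := lebesgue_number_lemma_of_metric (s := Icc a b)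
    (c := fun θ => Metric.ball θ (δ θ)) isCompact_Icc (fun _ => Metric.isOpen_ball)
    (fun x _ => mem_iUnion.2 ⟨x, Metric.mem_ball_self (hδ x)⟩)
  have hstep : ∀ x y, x ∈ Icc a b → x ≤ y → y < x + η → HasProfile ρ c x y := by
    intro x y hx hxy hy
    obtain ⟨θ, hθ⟩ := hη' x hx
    have h1 : x ∈ Metric.ball θ (δ θ) := hθ (Metric.mem_ball_self hη)
    have h2 : y ∈ Metric.ball θ (δ θ) := by
      apply hθ
      rw [Metric.mem_ball, Real.dist_eq, abs_of_nonneg (by linarith)]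
      linarith
    rw [Metric.mem_ball, Real.dist_eq, abs_lt] at h1 h2
    exact hP θ x y hxy (by linarith) (by linarith)
  have hn : ∀ n : ℕ, HasProfile ρ c a (min b (a + n * (η / 2))) := by
    intro n
    induction n with
    | zero => simpa [min_eq_right hab] using HasProfile.refl hc a
    | succ n ih =>
      have hle : a + (n : ℝ) * (η / 2) ≤ a + ((n + 1 : ℕ) : ℝ) * (η / 2) := by
        push_cast
        nlinarith
      have hge : a ≤ min b (a + n * (η / 2)) := le_min hab (by
        have : 0 ≤ (n : ℝ) * (η / 2) := by positivity
        linarith)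
      refine ih.trans hρ hge (min_le_min le_rfl hle) (hstep _ _ ⟨hge, min_le_left _ _⟩
        (min_le_min le_rfl hle) ?_)
      have : ((n + 1 : ℕ) : ℝ) * (η / 2) = n * (η / 2) + η / 2 := by push_cast; ring
      rcases le_total b (a + n * (η / 2)) with h | h
      · rw [min_eq_left h]
        linarith [min_le_left b (a + ((n + 1 : ℕ) : ℝ) * (η / 2))]
      · rw [min_eq_right h]
        linarith [min_le_right b (a + ((n + 1 : ℕ) : ℝ) * (η / 2))]
  obtain ⟨n, hn'⟩ := exists_nat_ge ((b - a) / (η / 2))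
  rw [div_le_iff₀ (by positivity)] at hn'
  have := hn n
  rwa [min_eq_left (by linarith)] at this

/-- A periodic profile: the angle as a function of the (normalized) swept area. -/
theorem exists_periodic_profile {ρ : ℝ → ℝ} {c : ℝ} (hρ : Continuous ρ)
    (hρ0 : ∀ t, 0 < ρ t) (hper : ∀ t, ρ (t + 2 * Real.pi) = ρ t)
    (hprof : HasProfile ρ c 0 (2 * Real.pi)) :
    ∃ α : ℝ → ℝ, ContDiff ℝ ∞ α ∧ Monotone α ∧
      (∀ t, α (t + ∫ θ in (0 : ℝ)..(2 * Real.pi), ρ θ ^ 2) = α t + 2 * Real.pi) ∧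
      ContDiff ℝ ∞ (fun t => ρ (α t)) ∧ ∀ t, ρ (α t) ^ 2 * deriv α t ≤ c := by
  obtain ⟨β, hβ, hβm, hβ0, hβ1, hρβ, hβc⟩ := hprof
  set L := ∫ θ in (0 : ℝ)..(2 * Real.pi), ρ θ ^ 2
  have hL : 0 < L := intervalIntegral.intervalIntegral_pos_of_pos
    ((hρ.pow 2).intervalIntegrable _ _) (fun t => pow_pos (hρ0 t) 2) Real.two_pi_pos
  obtain ⟨α, hα1, hα2, hα3⟩ := exists_equivariant_extension hL hβ0 hβ1
  have hperZ : ∀ t (n : ℤ), ρ (t + n * (2 * Real.pi)) = ρ t := fun t n =>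
    (show Function.Periodic ρ (2 * Real.pi) from hper).int_mul n t
  have hcase : ∀ (n : ℤ) (t : ℝ), (0 ≤ t - n * L ∧ β (t - n * L + L) = 2 * Real.pi) ∨
      (t - n * L ≤ 0 ∧ β (t - n * L) = 0) := by
    intro n t
    rcases le_total 0 (t - n * L) with h | h
    · exact Or.inl ⟨h, hβ1 _ (by linarith)⟩
    · exact Or.inr ⟨h, hβ0 _ h⟩
  -- One of the two copies of `β` rests at `0` or `2π`, where `ρ` has the same value.
  have hρα : ∀ n : ℤ, ∀ t ∈ Ioo ((n - 1 : ℝ) * L) ((n + 1 : ℝ) * L),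
      ρ (α t) = ρ (β (t - n * L)) + ρ (β (t - n * L + L)) - ρ 0 := by
    intro n t ht
    rw [hα3 n t ht]
    have h0 : ρ (2 * Real.pi) = ρ 0 := by simpa using hper 0
    rcases hcase n t with ⟨-, h⟩ | ⟨-, h⟩
    · rw [h, h0, ← hperZ (β (t - n * L)) n]
      ring_nf
    · rw [h, ← hperZ (β (t - n * L + L)) (n - 1)]
      push_cast
      ring_nf
  have hα : ContDiff ℝ ∞ α := contDiff_of_equivariant_extension hL hβ hα3
  refine ⟨α, hα, ?_, by simpa using hα1, ?_, ?_⟩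
  · refine monotone_of_equivariant hL hα1 fun s hs t ht hst => ?_
    rw [hα2 s hs, hα2 t ht]
    exact hβm hst
  · exact contDiff_of_equivariant_extension (c₀ := ρ 0) (c₁ := ρ 0) hL hρβ (g := fun t => ρ (α t))
      (f := fun t => ρ (β t)) (by simpa using hρα)
  · intro t
    obtain ⟨n, hn⟩ := exists_mem_Ioo_int_mul hL t
    have hdβ : Differentiable ℝ β := hβ.differentiable (by simp)
    have hd : deriv α t = deriv β (t - n * L) + deriv β (t - n * L + L) := by
      have e : α =ᶠ[nhds t] fun t => β (t - n * L) + β (t - n * L + L) - 2 * Real.pi +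
          n * (2 * Real.pi - 0) := Filter.eventuallyEq_of_mem (Ioo_mem_nhds hn.1 hn.2) (hα3 n)
      have e1 := (hdβ (t - n * L)).hasDerivAt.comp_sub_const t (n * L)
      have e2 := ((hdβ (t - n * L + L)).hasDerivAt.comp_add_const (t - n * L) L).comp_sub_const
        t (n * L)
      exact ((((e1.add e2).sub_const _).add_const _).congr_of_eventuallyEq e).deriv
    rw [hρα n t hn, hd]
    rcases hcase n t with ⟨h1, h⟩ | ⟨h1, h⟩
    · have h0 : ρ (2 * Real.pi) = ρ 0 := by simpa using hper 0
      have hz : deriv β (t - n * L + L) = 0 :=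
        deriv_eq_zero_of_eq_right hdβ fun s hs => hβ1 s (by linarith)
      rw [h, hz, h0]
      simpa using hβc (t - n * L)
    · have hz : deriv β (t - n * L) = 0 :=
        deriv_eq_zero_of_eq_left hdβ fun s hs => hβ0 s (by linarith)
      rw [h, hz]
      simpa using hβc (t - n * L + L)

/-- A circle map that transports the areal density `κ⁻²` to the areal density `ρ²` up to a
factor. -/
theorem exists_angle_map {ρ κ : ℝ → ℝ} {c : ℝ} (hρ : Continuous ρ)
    (hρ0 : ∀ t, 0 < ρ t) (hper : ∀ t, ρ (t + 2 * Real.pi) = ρ t)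
    (hprof : HasProfile ρ c 0 (2 * Real.pi)) (hκ : ContDiff ℝ ∞ κ) (hκ0 : ∀ t, 0 < κ t)
    (hκper : ∀ t, κ (t + 2 * Real.pi) = κ t) :
    ∃ μ : ℝ → ℝ, ContDiff ℝ ∞ μ ∧ Monotone μ ∧ (∀ t, μ (t + 2 * Real.pi) = μ t + 2 * Real.pi) ∧
      ContDiff ℝ ∞ (fun t => ρ (μ t)) ∧ ∀ t, ρ (μ t) ^ 2 * deriv μ t ≤
        c * ((∫ θ in (0 : ℝ)..(2 * Real.pi), ρ θ ^ 2) /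
          ∫ θ in (0 : ℝ)..(2 * Real.pi), (κ θ ^ 2)⁻¹) * (κ t ^ 2)⁻¹ := by
  obtain ⟨α, hα, hαm, hαL, hρα, hαc⟩ := exists_periodic_profile hρ hρ0 hper hprof
  have hw : ContDiff ℝ ∞ fun t => (κ t ^ 2)⁻¹ :=
    (hκ.pow 2).inv fun t => (pow_pos (hκ0 t) 2).ne'
  have hw0 : ∀ t, 0 < (κ t ^ 2)⁻¹ := fun t => inv_pos.2 (pow_pos (hκ0 t) 2)
  have hint : ∀ a b, IntervalIntegrable (fun t => (κ t ^ 2)⁻¹) volume a b := fun a b =>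
    hw.continuous.intervalIntegrable a b
  set L := ∫ θ in (0 : ℝ)..(2 * Real.pi), ρ θ ^ 2
  set L₁ := ∫ θ in (0 : ℝ)..(2 * Real.pi), (κ θ ^ 2)⁻¹ with hL₁
  have hL : 0 < L := intervalIntegral.intervalIntegral_pos_of_pos
    ((hρ.pow 2).intervalIntegrable _ _) (fun t => pow_pos (hρ0 t) 2) Real.two_pi_pos
  have hL₁0 : 0 < L₁ := intervalIntegral.intervalIntegral_pos_of_pos (hint _ _) hw0
    Real.two_pi_pos
  -- `φ` sends an angle to the area swept for the density `κ⁻²`, rescaled to total `L`; `α` turns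
  -- swept area back into an angle.
  set φ : ℝ → ℝ := fun t => L / L₁ * ∫ θ in (0 : ℝ)..t, (κ θ ^ 2)⁻¹ with hφ
  have hφs : ContDiff ℝ ∞ φ := contDiff_const.mul (contDiff_primitive hw)
  have hφd : ∀ t, HasDerivAt φ (L / L₁ * (κ t ^ 2)⁻¹) t := fun t =>
    (hasDerivAt_primitive hw.continuous t).const_mul _
  have hφm : Monotone φ := by
    refine monotone_of_deriv_nonneg (fun t => (hφd t).differentiableAt) fun t => ?_
    rw [(hφd t).deriv]
    have := hw0 t
    positivity
  have hφL : ∀ t, φ (t + 2 * Real.pi) = φ t + L := by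
    intro t
    have hp : Function.Periodic (fun θ => (κ θ ^ 2)⁻¹) (2 * Real.pi) := fun θ => by
      simp only [hκper]
    have e := hp.intervalIntegral_add_eq t 0
    rw [zero_add, ← hL₁] at e
    simp only [hφ]
    rw [← intervalIntegral.integral_add_adjacent_intervals (hint 0 t) (hint t _), e]
    field_simp
  refine ⟨fun t => α (φ t), hα.comp hφs, hαm.comp hφm, ?_, hρα.comp hφs, ?_⟩
  · intro t
    simp only [hφL, hαL]
  · intro t
    have hd : deriv (fun t => α (φ t)) t = deriv α (φ t) * (L / L₁ * (κ t ^ 2)⁻¹) :=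
      ((hα.differentiable (by simp) (φ t)).hasDerivAt.comp t (hφd t)).deriv
    rw [hd, ← mul_assoc, mul_assoc c]
    have := hw0 t
    gcongr
    exact hαc (φ t)

/-- A smooth periodic approximation of the inverse of the radial function. -/
theorem IsPointedBody.exists_approx_inv_radius {Δ : Set (ℝ × ℝ)} {o : ℝ × ℝ}
    (h : IsPointedBody Δ o) {c : ℝ} (hc : 1 < c) :
    ∃ κ : ℝ → ℝ, ContDiff ℝ ∞ κ ∧ (∀ t, 0 < κ t) ∧ (∀ t, κ (t + 2 * Real.pi) = κ t) ∧
      ∃ d > 0, ∀ t, 1 + d ≤ radius Δ o t * κ t ∧ radius Δ o t * κ t ≤ c := by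
  have hcont : Continuous (gauge ((Homeomorph.addLeft o) ⁻¹' Δ)) :=
    continuous_gauge h.convex_preimage h.preimage_mem_nhds
  set G := gauge ((Homeomorph.addLeft o) ⁻¹' Δ)
  have hp : Function.Periodic (fun t => G (dir t)) (2 * Real.pi) := fun t => by
    simp only [dir_add_two_pi]
  have hcompact : IsCompact (range fun t => G (dir t)) :=
    hp.compact_of_continuous Real.two_pi_pos.ne' (hcont.comp contDiff_dir.continuous)
  obtain ⟨m, ⟨t₀, rfl⟩, hm⟩ := hcompact.exists_isLeast (range_nonempty _)
  have hm0 : 0 < G (dir t₀) := h.gauge_dir_pos t₀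
  set d := (c - 1) / 4 with hd
  have hd0 : 0 < d := by rw [hd]; linarith
  -- With `c = 1 + 4d`, approximating `(1 + 2d) G` within `d * min G` lands between `(1 + d) G` and
  -- `(1 + 3d) G`.
  have hcG : Continuous fun x => (1 + 2 * d) * G x := continuous_const.mul hcont
  obtain ⟨f, hf, hfG, -⟩ := hcG.exists_contDiff_approx ⊤ (ε := fun _ => d * G (dir t₀)) continuous_const
    (fun _ => by positivity)
  have key : ∀ t, (1 + d) * G (dir t) ≤ f (dir t) ∧ f (dir t) ≤ c * G (dir t) := by
    intro t
    have h1 := hfG (dir t)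
    have h2 : G (dir t₀) ≤ G (dir t) := hm ⟨t, rfl⟩
    rw [Real.dist_eq, abs_lt] at h1
    have hc' : c = 1 + 4 * d := by rw [hd]; ring
    rw [hc']
    constructor <;> nlinarith
  have hG : ∀ t, 0 < G (dir t) := h.gauge_dir_pos
  refine ⟨fun t => f (dir t), hf.comp contDiff_dir, fun t => ?_, fun t => ?_, d, hd0, fun t => ?_⟩
  · have := hG t
    exact lt_of_lt_of_le (by positivity) (key t).1
  · simp only [dir_add_two_pi]
  · have e : radius Δ o t = (G (dir t))⁻¹ := rfl
    rw [e, ← div_eq_inv_mul, le_div_iff₀ (hG t), div_le_iff₀ (hG t)]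
    exact key t

/-! ### Cyclically ordered angles -/

/-- The angles `θ 0, …, θ (N - 1)`, followed by `θ 0 + 2π`. -/
def cyclicExt {N : ℕ} [NeZero N] (θ : Fin N → ℝ) (j : ℕ) : ℝ :=
  if h : j < N then θ ⟨j, h⟩ else θ 0 + 2 * Real.pi

section CyclicExt

variable {N : ℕ} [NeZero N] {θ t : Fin N → ℝ}

theorem cyclicExt_val (θ : Fin N → ℝ) (i : Fin N) : cyclicExt θ i = θ i := by
  simp [cyclicExt]

theorem cyclicExt_zero (θ : Fin N → ℝ) : cyclicExt θ 0 = θ 0 := by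
  rw [← cyclicExt_val θ 0]
  simp

theorem cyclicExt_of_le (θ : Fin N → ℝ) {j : ℕ} (hj : N ≤ j) :
    cyclicExt θ j = θ 0 + 2 * Real.pi := by
  simp [cyclicExt, not_lt.2 hj]

theorem cyclicExt_lt_succ (hθ : StrictMono θ) (hθ' : ∀ i j, θ j < θ i + 2 * Real.pi) {j : ℕ}
    (hj : j < N) : cyclicExt θ j < cyclicExt θ (j + 1) := by
  rw [cyclicExt, dif_pos hj]
  by_cases h : j + 1 < N
  · rw [cyclicExt, dif_pos h]
    exact hθ (by simp)
  · rw [cyclicExt, dif_neg h]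
    exact hθ' _ _

theorem monotone_cyclicExt (hθ : StrictMono θ) (hθ' : ∀ i j, θ j < θ i + 2 * Real.pi) :
    Monotone (cyclicExt θ) := by
  refine monotone_nat_of_le_succ fun j => ?_
  rcases lt_or_ge j N with h | h
  · exact (cyclicExt_lt_succ hθ hθ' h).le
  · rw [cyclicExt_of_le θ h, cyclicExt_of_le θ (by omega)]

theorem cyclicExt_succ_le (hθ : StrictMono θ) (hθ' : ∀ i j, θ j < θ i + 2 * Real.pi) (i : Fin N) :
    cyclicExt θ (i + 1) ≤ θ i + 2 * Real.pi := by
  have h1 : cyclicExt θ (i + 1) ≤ θ 0 + 2 * Real.pi := by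
    rw [← cyclicExt_of_le θ le_rfl]
    exact monotone_cyclicExt hθ hθ' i.2
  have h2 : θ 0 ≤ θ i := hθ.monotone (Fin.zero_le _)
  linarith

theorem map_cyclicExt {f : ℝ → ℝ} (hf : ∀ x, f (x + 2 * Real.pi) = f x + 2 * Real.pi)
    (h : ∀ i, f (θ i) = t i) (j : ℕ) : f (cyclicExt θ j) = cyclicExt t j := by
  by_cases hj : j < N
  · rw [cyclicExt, dif_pos hj, cyclicExt, dif_pos hj, h]
  · rw [cyclicExt, dif_neg hj, cyclicExt, dif_neg hj, hf, h]

theorem onRay_cyclicExt_succ {o : ℝ × ℝ} {p : Fin N → ℝ × ℝ} (h : ∀ i, OnRay o (θ i) (p i))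
    (i : Fin N) : OnRay o (cyclicExt θ (i + 1)) (p (i + 1)) := by
  by_cases hi : (i : ℕ) + 1 < N
  · have : i + 1 = ⟨i + 1, hi⟩ := Fin.ext (Fin.val_add_one_of_lt' hi)
    rw [cyclicExt, dif_pos hi, this]
    exact h _
  · have : i + 1 = 0 := by
      apply Fin.ext
      have hN : (i : ℕ) + 1 = N := by have := i.2; omega
      rw [Fin.val_add, Fin.val_one', Nat.add_mod_mod, hN]
      simp
    rw [cyclicExt, dif_neg hi, this]
    simpa using (h 0).add_int_mul 1

theorem sum_cyclicExt_step (t : Fin N → ℝ) {s : ℕ → ℝ} {k : ℕ} (h1 : ∀ j < k, s j = 1)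
    (h0 : ∀ j, k ≤ j → s j = 0) (n : ℕ) :
    ∑ j ∈ Finset.range n, (cyclicExt t (j + 1) - cyclicExt t j) * s j =
      cyclicExt t (min n k) - cyclicExt t 0 := by
  induction n with
  | zero => simp
  | succ n ih =>
    rw [Finset.sum_range_succ, ih]
    rcases lt_or_ge n k with h | h
    · rw [h1 n h, min_eq_left h.le, min_eq_left h]
      ring
    · rw [h0 n h, min_eq_right h, min_eq_right (h.trans n.le_succ)]
      ring

/-- A smooth monotone map of the circle with prescribed values at cyclically ordered points. -/
theorem exists_smooth_interpolation (hθ : StrictMono θ) (hθ' : ∀ i j, θ j < θ i + 2 * Real.pi)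
    (ht : StrictMono t) (ht' : ∀ i j, t j < t i + 2 * Real.pi) :
    ∃ τ : ℝ → ℝ, ContDiff ℝ ∞ τ ∧ Monotone τ ∧ (∀ x, τ (x + 2 * Real.pi) = τ x + 2 * Real.pi) ∧
      ∀ i, τ (θ i) = t i := by
  set s : ℕ → ℝ → ℝ := fun j x =>
    Real.smoothTransition ((x - cyclicExt θ j) / (cyclicExt θ (j + 1) - cyclicExt θ j)) with hs
  have hmono := monotone_cyclicExt hθ hθ'
  have hpos : ∀ j < N, 0 < cyclicExt θ (j + 1) - cyclicExt θ j := fun j hj =>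
    sub_pos.2 (cyclicExt_lt_succ hθ hθ' hj)
  -- The `j`-th summand climbs by the `j`-th gap of `t` while `x + θ 0` crosses the `j`-th gap of
  -- `θ`; the shift by `θ 0` makes the period start at `0`.
  set f : ℝ → ℝ := fun x => t 0 +
    ∑ j ∈ Finset.range N, (cyclicExt t (j + 1) - cyclicExt t j) * s j (x + θ 0) with hf
  have hfs : ContDiff ℝ ∞ f := by
    refine contDiff_const.add (ContDiff.sum fun j _ => contDiff_const.mul ?_)
    exact Real.smoothTransition.contDiff.comp
      (((contDiff_id.add contDiff_const).sub contDiff_const).div_const _)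
  have hfm : Monotone f := by
    intro x y hxy
    refine add_le_add le_rfl (Finset.sum_le_sum fun j hj => ?_)
    have h1 := hpos j (Finset.mem_range.1 hj)
    have h2 := cyclicExt_lt_succ ht ht' (Finset.mem_range.1 hj)
    refine mul_le_mul_of_nonneg_left ?_ (by linarith)
    exact Real.smoothTransition.monotone (by gcongr)
  have hval : ∀ k ≤ N, ∀ x, (∀ j < k, cyclicExt θ (j + 1) ≤ x + θ 0) →
      (∀ j, k ≤ j → x + θ 0 ≤ cyclicExt θ j) → f x = cyclicExt t k := by
    intro k hk x h1 h0
    set σ : ℕ → ℝ := fun j => if j < k then 1 else 0 with hσ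
    have e : ∀ j ∈ Finset.range N, (cyclicExt t (j + 1) - cyclicExt t j) * s j (x + θ 0) =
        (cyclicExt t (j + 1) - cyclicExt t j) * σ j := by
      intro j hj
      have hp := hpos j (Finset.mem_range.1 hj)
      congr 1
      simp only [hs, hσ]
      split_ifs with hjk
      · apply Real.smoothTransition.one_of_one_le
        rw [one_le_div hp]
        linarith [h1 j hjk]
      · apply Real.smoothTransition.zero_of_nonpos
        exact div_nonpos_of_nonpos_of_nonneg (by linarith [h0 j (not_lt.1 hjk)]) hp.le
    simp only [hf]
    rw [Finset.sum_congr rfl e, sum_cyclicExt_step t (k := k) (fun j hj => if_pos hj)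
      (fun j hj => if_neg (not_lt.2 hj)), min_eq_right hk, cyclicExt_zero]
    ring
  have hf0 : ∀ x ≤ 0, f x = t 0 := by
    intro x hx
    rw [hval 0 (Nat.zero_le _) x (by simp), cyclicExt_zero]
    intro j _
    have := hmono (Nat.zero_le j)
    rw [cyclicExt_zero] at this
    linarith
  have hf1 : ∀ x, 2 * Real.pi ≤ x → f x = t 0 + 2 * Real.pi := by
    intro x hx
    have hle : ∀ j, cyclicExt θ j ≤ θ 0 + 2 * Real.pi := by
      intro j
      rw [← cyclicExt_of_le θ (le_max_right j N)]
      exact hmono (le_max_left j N)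
    have : f x = f (2 * Real.pi) := by
      refine le_antisymm (add_le_add le_rfl (Finset.sum_le_sum fun j hj => ?_)) (hfm hx)
      have h1 := hpos j (Finset.mem_range.1 hj)
      have h2 := cyclicExt_lt_succ ht ht' (Finset.mem_range.1 hj)
      refine mul_le_mul_of_nonneg_left ?_ (by linarith)
      simp only [hs]
      rw [Real.smoothTransition.one_of_one_le (x := (2 * Real.pi + θ 0 - cyclicExt θ j) / _)]
      · exact Real.smoothTransition.le_one _
      · rw [one_le_div h1]
        linarith [hle (j + 1)]
    rw [this, hval N le_rfl, cyclicExt_of_le t le_rfl]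
    · intro j _
      linarith [hle (j + 1)]
    · intro j hj
      rw [cyclicExt_of_le θ hj]
      linarith
  obtain ⟨g, hg1, hg2, hg3⟩ := exists_equivariant_extension Real.two_pi_pos hf0 hf1
  have hg1' : ∀ x, g (x + 2 * Real.pi) = g x + 2 * Real.pi := fun x => by
    rw [hg1]; ring
  have hgm : Monotone g := by
    refine monotone_of_equivariant Real.two_pi_pos hg1 fun x hx y hy hxy => ?_
    rw [hg2 x hx, hg2 y hy]
    exact hfm hxy
  refine ⟨fun x => g (x - θ 0), ?_, fun x y hxy => hgm (sub_le_sub_right hxy _), ?_, ?_⟩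
  · exact (contDiff_of_equivariant_extension Real.two_pi_pos hfs hg3).comp
      (contDiff_id.sub contDiff_const)
  · intro x
    simp only
    rw [← hg1']
    ring_nf
  · intro i
    simp only
    have h1 : θ 0 ≤ θ i := hθ.monotone (Fin.zero_le _)
    rw [hg2 _ ⟨by linarith, by linarith [hθ' 0 i]⟩, hval i i.2.le, cyclicExt_val]
    · intro j hj
      rw [sub_add_cancel, ← cyclicExt_val θ i]
      exact hmono hj
    · intro j hj
      rw [sub_add_cancel, ← cyclicExt_val θ i]
      exact hmono hj

end CyclicExt

/-- Lifts of cyclically ordered angles under a monotone circle map are cyclically ordered. -/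
theorem exists_lift_of_cyclic {N : ℕ} {μ : ℝ → ℝ} (hμ : Continuous μ) (hμm : Monotone μ)
    (hμp : ∀ x, μ (x + 2 * Real.pi) = μ x + 2 * Real.pi) {ψ : Fin N → ℝ} (hψ : StrictMono ψ)
    (hψ' : ∀ i j, ψ j < ψ i + 2 * Real.pi) :
    ∃ t : Fin N → ℝ, StrictMono t ∧ (∀ i j, t j < t i + 2 * Real.pi) ∧ ∀ i, μ (t i) = ψ i := by
  have hsurj : Function.Surjective μ := by
    intro y
    have hn := add_int_mul_of_equivariant hμp
    have hpi := Real.two_pi_pos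
    have e1 := hn ⌊(y - μ 0) / (2 * Real.pi)⌋ 0
    have e2 := hn (⌊(y - μ 0) / (2 * Real.pi)⌋ + 1) 0
    have h1 := Int.floor_le ((y - μ 0) / (2 * Real.pi))
    have h2 := (Int.lt_floor_add_one ((y - μ 0) / (2 * Real.pi))).le
    rw [le_div_iff₀ hpi] at h1
    rw [div_le_iff₀ hpi] at h2
    push_cast at e2
    exact mem_range_of_exists_le_of_exists_ge hμ ⟨_, by rw [e1]; linarith⟩
      ⟨0 + (⌊(y - μ 0) / (2 * Real.pi)⌋ + 1) * (2 * Real.pi), by rw [e2]; linarith⟩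
  choose t ht using fun i => hsurj (ψ i)
  refine ⟨t, fun i j hij => ?_, fun i j => ?_, ht⟩
  · exact hμm.reflect_lt (by rw [ht, ht]; exact hψ hij)
  · exact hμm.reflect_lt (by rw [hμp, ht, ht]; exact hψ' i j)

/-! ### Maps between marked domains -/

/-- In polar coordinates: the map `r, θ ↦ S v • b (θ + X v * k θ)` with `v = r * κ θ`, where
`b s = ρ (μ s) • dir (μ s)` runs along the boundary with radial function `ρ`. -/
def polarModel (S X κ k ρ μ : ℝ → ℝ) (p : ℝ × ℝ) : ℝ × ℝ :=
  S (p.1 * κ p.2) • ρ (μ (p.2 + X (p.1 * κ p.2) * k p.2)) • dir (μ (p.2 + X (p.1 * κ p.2) * k p.2))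

section PolarModel

variable {S X κ k ρ μ : ℝ → ℝ}

theorem contDiff_boundary (hμ : ContDiff ℝ ∞ μ) (hρμ : ContDiff ℝ ∞ fun s => ρ (μ s)) :
    ContDiff ℝ ∞ fun s => ρ (μ s) • dir (μ s) :=
  hρμ.smul (contDiff_dir.comp hμ)

theorem contDiff_scaled (hκ : ContDiff ℝ ∞ κ) : ContDiff ℝ ∞ fun p : ℝ × ℝ => p.1 * κ p.2 :=
  contDiff_fst.mul (hκ.comp contDiff_snd)

theorem contDiff_shifted (hX : ContDiff ℝ ∞ X) (hκ : ContDiff ℝ ∞ κ) (hk : ContDiff ℝ ∞ k) :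
    ContDiff ℝ ∞ fun p : ℝ × ℝ => p.2 + X (p.1 * κ p.2) * k p.2 :=
  contDiff_snd.add ((hX.comp (contDiff_scaled hκ)).mul (hk.comp contDiff_snd))

theorem contDiff_polarModel (hS : ContDiff ℝ ∞ S) (hX : ContDiff ℝ ∞ X) (hκ : ContDiff ℝ ∞ κ)
    (hk : ContDiff ℝ ∞ k) (hμ : ContDiff ℝ ∞ μ) (hρμ : ContDiff ℝ ∞ fun s => ρ (μ s)) :
    ContDiff ℝ ∞ (polarModel S X κ k ρ μ) :=
  (hS.comp (contDiff_scaled hκ)).smul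
    ((contDiff_boundary hμ hρμ).comp (contDiff_shifted hX hκ hk))

theorem polarModel_add_two_pi (hκ : ∀ x, κ (x + 2 * Real.pi) = κ x)
    (hk : ∀ x, k (x + 2 * Real.pi) = k x) (hρ : ∀ x, ρ (x + 2 * Real.pi) = ρ x)
    (hμ : ∀ x, μ (x + 2 * Real.pi) = μ x + 2 * Real.pi) (r θ : ℝ) :
    polarModel S X κ k ρ μ (r, θ + 2 * Real.pi) = polarModel S X κ k ρ μ (r, θ) := by
  simp only [polarModel, hκ, hk]
  rw [add_right_comm, hμ, hρ, dir_add_two_pi]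

/-- Where the boundary shift is switched off, the Jacobian of the model is the product of the radial
speed and the areal speed of the boundary curve. -/
theorem jac_polarModel_inner (hS : ContDiff ℝ ∞ S) (hκ : ContDiff ℝ ∞ κ)
    (hμ : ContDiff ℝ ∞ μ) (hρμ : ContDiff ℝ ∞ fun s => ρ (μ s)) {r θ v₁ : ℝ}
    (hX : ∀ v ≤ v₁, X v = 0) (hv : r * κ θ < v₁) :
    jac (polarModel S X κ k ρ μ) (r, θ) =
      deriv S (r * κ θ) * κ θ * S (r * κ θ) * (ρ (μ θ) ^ 2 * deriv μ θ) := by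
  have hev : polarModel S X κ k ρ μ =ᶠ[nhds (r, θ)]
      fun p => S (p.1 * κ p.2) • (fun s => ρ (μ s) • dir (μ s)) p.2 := by
    have : ∀ᶠ p : ℝ × ℝ in nhds (r, θ), p.1 * κ p.2 < v₁ :=
      (contDiff_scaled hκ).continuous.continuousAt.eventually_lt continuousAt_const hv
    filter_upwards [this] with p hp
    simp [polarModel, hX _ hp.le]
  have hdir : HasDerivAt (fun s => dir (μ s))
      (deriv μ θ • (-Real.sin (μ θ), Real.cos (μ θ))) θ :=
    (hasDerivAt_dir (μ θ)).scomp θ (hμ.differentiable (by simp) θ).hasDerivAt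
  have hb : HasDerivAt (fun s => ρ (μ s) • dir (μ s)) _ θ :=
    (hρμ.differentiable (by simp) θ).hasDerivAt.smul hdir
  have hq : HasFDerivAt (fun p : ℝ × ℝ => S (p.1 * κ p.2)) _ (r, θ) :=
    (hS.differentiable (by simp) (r * κ θ)).hasDerivAt.comp_hasFDerivAt (r, θ)
      ((hasFDerivAt_fst (𝕜 := ℝ)).mul
        ((hκ.differentiable (by simp) θ).hasDerivAt.comp_hasFDerivAt (r, θ) hasFDerivAt_snd))
  rw [jac_smul hb hq hev]
  have hsc := Real.sin_sq_add_cos_sq (μ θ)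
  simp [dir]
  refine Or.inl ?_
  linear_combination (ρ (μ θ) ^ 2 * deriv μ θ) * hsc

/-- Where `S = 1` the model depends on `(r, θ)` only through the shifted angle. -/
theorem jac_polarModel_outer (hX : ContDiff ℝ ∞ X) (hκ : ContDiff ℝ ∞ κ) (hk : ContDiff ℝ ∞ k)
    (hμ : ContDiff ℝ ∞ μ) (hρμ : ContDiff ℝ ∞ fun s => ρ (μ s)) {r θ : ℝ}
    (hS : ∀ v, 1 ≤ v → S v = 1) (hv : 1 < r * κ θ) :
    jac (polarModel S X κ k ρ μ) (r, θ) = 0 := by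
  refine jac_eq_zero_of_factor (b := fun s => ρ (μ s) • dir (μ s))
    ((contDiff_boundary hμ hρμ).differentiable (by simp) _)
    ((contDiff_shifted hX hκ hk).differentiable (by simp) _) ?_
  have : ∀ᶠ p : ℝ × ℝ in nhds (r, θ), 1 < p.1 * κ p.2 :=
    continuousAt_const.eventually_lt (contDiff_scaled hκ).continuous.continuousAt hv
  filter_upwards [this] with p hp
  simp [polarModel, hS _ hp.le]

end PolarModel

theorem exists_smooth_cutoff {v₀ v₁ : ℝ} (h : v₀ < v₁) :
    ∃ X : ℝ → ℝ, ContDiff ℝ ∞ X ∧ (∀ v ≤ v₀, X v = 0) ∧ ∀ v, v₁ ≤ v → X v = 1 := by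
  refine ⟨fun v => Real.smoothTransition ((v - v₀) / (v₁ - v₀)),
    Real.smoothTransition.contDiff.comp ((contDiff_id.sub contDiff_const).div_const _), ?_, ?_⟩
  · intro v hv
    exact Real.smoothTransition.zero_of_nonpos
      (div_nonpos_of_nonpos_of_nonneg (by linarith) (by linarith))
  · intro v hv
    apply Real.smoothTransition.one_of_one_le
    rw [one_le_div (by linarith)]
    linarith

theorem IsPointedBody.hasProfile_radius {Δ : Set (ℝ × ℝ)} {o : ℝ × ℝ} (h : IsPointedBody Δ o)
    (hs : HasSmoothBoundary Δ ∨ IsConvexPolygon Δ) {c : ℝ} (hc : 1 < c) :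
    HasProfile (radius Δ o) (c ^ 2) 0 (2 * Real.pi) :=
  hasProfile_of_local (by positivity) h.continuous_radius
    (fun θ => exists_hasProfile_of_sides hc h.continuous_radius h.radius_pos
      (h.exists_contDiffOn_radius hs θ)) Real.two_pi_pos.le

/-- Between two convex bodies of area one, there is a circle map that almost preserves the areal
densities. -/
theorem exists_angle_map_of_bodies {Δ₁ Δ₂ : Set (ℝ × ℝ)} {o₁ o₂ : ℝ × ℝ}
    (h₁ : IsPointedBody Δ₁ o₁) (h₂ : IsPointedBody Δ₂ o₂) (hv₁ : volume Δ₁ = 1)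
    (hv₂ : volume Δ₂ = 1) (hs : HasSmoothBoundary Δ₂ ∨ IsConvexPolygon Δ₂) {c : ℝ} (hc : 1 < c)
    {κ : ℝ → ℝ} (hκ : ContDiff ℝ ∞ κ) (hκ0 : ∀ t, 0 < κ t)
    (hκper : ∀ t, κ (t + 2 * Real.pi) = κ t) (hκc : ∀ t, radius Δ₁ o₁ t * κ t ≤ c) :
    ∃ μ : ℝ → ℝ, ContDiff ℝ ∞ μ ∧ Monotone μ ∧ (∀ t, μ (t + 2 * Real.pi) = μ t + 2 * Real.pi) ∧
      ContDiff ℝ ∞ (fun t => radius Δ₂ o₂ (μ t)) ∧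
      ∀ t, radius Δ₂ o₂ (μ t) ^ 2 * deriv μ t ≤ c ^ 4 * (κ t ^ 2)⁻¹ := by
  obtain ⟨μ, hμ, hμm, hμp, hρμ, hμc⟩ := exists_angle_map h₂.continuous_radius h₂.radius_pos
    (radius_add_two_pi Δ₂ o₂) (h₂.hasProfile_radius hs hc) hκ hκ0 hκper
  refine ⟨μ, hμ, hμm, hμp, hρμ, fun t => (hμc t).trans ?_⟩
  have e₂ := h₂.integral_radius_sq hv₂ 0
  have e₁ := h₁.integral_radius_sq hv₁ 0
  rw [zero_add] at e₁ e₂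
  -- The value `2` is twice the area of `Δ₁`; `ρ₁ κ ≤ c` bounds `ρ₁²` by `c² κ⁻²`. Equality of the
  -- areas is used here to compare the total masses.
  have hle : 2 ≤ c ^ 2 * ∫ θ in (0 : ℝ)..(2 * Real.pi), (κ θ ^ 2)⁻¹ := by
    refine e₁.ge.trans ?_
    rw [← intervalIntegral.integral_const_mul]
    have i₁ : Continuous fun θ => radius Δ₁ o₁ θ ^ 2 := h₁.continuous_radius.pow 2
    have i₂ : Continuous fun θ => c ^ 2 * (κ θ ^ 2)⁻¹ := continuous_const.mul
      ((hκ.continuous.pow 2).inv₀ fun θ => (pow_pos (hκ0 θ) 2).ne')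
    refine intervalIntegral.integral_mono_on Real.two_pi_pos.le
      (i₁.intervalIntegrable _ _) (i₂.intervalIntegrable _ _) fun θ _ => ?_
    rw [← div_eq_mul_inv, le_div_iff₀ (pow_pos (hκ0 θ) 2), ← mul_pow]
    exact pow_le_pow_left₀ (mul_pos (h₁.radius_pos θ) (hκ0 θ)).le (hκc θ) 2
  have hI : 0 < ∫ θ in (0 : ℝ)..(2 * Real.pi), (κ θ ^ 2)⁻¹ := by
    by_contra hcon
    push Not at hcon
    nlinarith [sq_nonneg c]
  rw [e₂]
  have := inv_pos.2 (pow_pos (hκ0 t) 2)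
  have h3 : 2 / ∫ θ in (0 : ℝ)..(2 * Real.pi), (κ θ ^ 2)⁻¹ ≤ c ^ 2 := by
    rwa [div_le_iff₀ hI]
  calc c ^ 2 * (2 / ∫ θ in (0 : ℝ)..(2 * Real.pi), (κ θ ^ 2)⁻¹) * (κ t ^ 2)⁻¹
      ≤ c ^ 2 * c ^ 2 * (κ t ^ 2)⁻¹ := by gcongr
    _ = c ^ 4 * (κ t ^ 2)⁻¹ := by ring

theorem exists_bound_of_periodic {κ : ℝ → ℝ} (hκ : Continuous κ)
    (hper : ∀ t, κ (t + 2 * Real.pi) = κ t) : ∃ M > 0, ∀ t, κ t ≤ M := by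
  obtain ⟨M, hM⟩ := ((show Function.Periodic κ (2 * Real.pi) from hper).compact_of_continuous
    Real.two_pi_pos.ne' hκ).bddAbove
  exact ⟨max M 1, by positivity, fun t => (hM ⟨t, rfl⟩).trans (le_max_left _ _)⟩

/-- For marked domains there are smooth maps of the plane that map the first domain to the second
one, and the boundary arcs to the corresponding arcs, with Jacobian bounded by a constant
arbitrarily close to `1`. -/
theorem MarkedDomain.exists_map {N : ℕ} [NeZero N] (D₁ D₂ : MarkedDomain N) {c : ℝ} (hc : 1 < c) :
    ∃ F : ℝ × ℝ → ℝ × ℝ, ContDiff ℝ ∞ F ∧ (∀ z, F z ∈ D₂.carrier) ∧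
      (∀ i, ∀ z ∈ D₁.arc i, F z ∈ D₂.arc i) ∧ ∀ z, |jac F z| ≤ c ^ 6 := by
  obtain ⟨o₁, ho₁, θ, hθ, hθ', hθp⟩ := D₁.ordered
  obtain ⟨o₂, ho₂, ψ, hψ, hψ', hψp⟩ := D₂.ordered
  have h₁ : IsPointedBody D₁.carrier o₁ := ⟨D₁.isCompact, D₁.convex, ho₁⟩
  have h₂ : IsPointedBody D₂.carrier o₂ := ⟨D₂.isCompact, D₂.convex, ho₂⟩
  obtain ⟨κ, hκ, hκ0, hκper, d, hd, hκd⟩ := h₁.exists_approx_inv_radius hc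
  obtain ⟨μ, hμ, hμm, hμp, hρμ, hμc⟩ := exists_angle_map_of_bodies h₁ h₂ D₁.area D₂.area
    D₂.boundary hc hκ hκ0 hκper fun t => (hκd t).2
  -- `μ` alone ignores the marked points; `μ ∘ τ` will send the angles `θ i` to `ψ i`.
  obtain ⟨t, ht, ht', htμ⟩ := exists_lift_of_cyclic hμ.continuous hμm hμp hψ hψ'
  obtain ⟨τ, hτ, hτm, hτp, hτθ⟩ := exists_smooth_interpolation hθ hθ' ht ht'
  obtain ⟨S, hS, hSm, hSc, v, hv, hS0, hS1⟩ := exists_smooth_step hc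
  -- The shift from `x` to `τ x` starts only after `v = 1`, where the Jacobian already vanishes, and
  -- is complete at `v = 1 + d`, before the boundary of `Δ₁` is reached.
  obtain ⟨X, hX, hX0, hX1⟩ := exists_smooth_cutoff (show 1 + d / 2 < 1 + d by linarith)
  obtain ⟨M, hM, hκM⟩ := exists_bound_of_periodic hκ.continuous hκper
  have hS1' : ∀ v, 1 ≤ v → S v = 1 := fun v hv => hS1 v (by linarith)
  have hS01 : ∀ t, 0 ≤ S t ∧ S t ≤ 1 := by
    intro t
    constructor
    · rw [← hS0 (min t v) (min_le_right _ _)]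
      exact hSm (min_le_left _ _)
    · rw [← hS1' (max t 1) (le_max_right _ _)]
      exact hSm (le_max_left _ _)
  have hSle : ∀ t, 0 ≤ t → S t ≤ c * t := by
    intro t ht
    have := image_sub_le_mul_sub_of_deriv_le (hS.differentiable (by simp)) hSc ht
    rwa [hS0 0 hv.le, sub_zero, sub_zero] at this
  set k : ℝ → ℝ := fun x => τ x - x with hk
  have hks : ContDiff ℝ ∞ k := hτ.sub contDiff_id
  have hkp : ∀ x, k (x + 2 * Real.pi) = k x := fun x => by simp only [hk, hτp]; ring
  set H := polarModel S X κ k (radius D₂.carrier o₂) μ with hH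
  have hHs : ContDiff ℝ ∞ H := contDiff_polarModel hS hX hκ hks hμ hρμ
  have hHp : ∀ r x, H (r, x + 2 * Real.pi) = H (r, x) :=
    polarModel_add_two_pi hκper hkp (radius_add_two_pi _ _) hμp
  have hH0 : ∀ r < v / M, ∀ x, H (r, x) = 0 := by
    intro r hr x
    have : r * κ x ≤ v := by
      rcases le_or_gt r 0 with h | h
      · nlinarith [hκ0 x]
      · rw [lt_div_iff₀ hM] at hr
        nlinarith [hκM x]
    simp [hH, polarModel, hS0 _ this]
  have hP : ContDiff ℝ ∞ (ofPolar H) := contDiff_ofPolar hHs hHp (by positivity) hH0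
  refine ⟨fun z => o₂ + ofPolar H (z - o₁),
    contDiff_const.add (hP.comp (contDiff_id.sub contDiff_const)), ?_, ?_, ?_⟩
  · intro z
    simp only [ofPolar, hH, polarModel]
    rw [smul_smul]
    have hρ := fun x => (h₂.radius_pos x).le
    rw [h₂.mem_iff (mul_nonneg (hS01 _).1 (hρ _))]
    exact mul_le_of_le_one_left (hρ _) (hS01 _).2
  · intro i z hz
    have hlt := cyclicExt_lt_succ hθ hθ' i.2
    rw [cyclicExt_val] at hlt
    obtain ⟨x, hx1, hx2, hxz⟩ := h₁.exists_onRay_of_mem_ccwArc (D₁.point_mem i)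
      (D₁.point_mem (i + 1)) (hθp i) (onRay_cyclicExt_succ hθp i) hlt
      (cyclicExt_succ_le hθ hθ' i) hz
    have hz' := h₁.eq_of_onRay hxz hz.1
    have hF : o₂ + ofPolar H (z - o₁) =
        o₂ + radius D₂.carrier o₂ (μ (τ x)) • dir (μ (τ x)) := by
      rw [hz', add_sub_cancel_left, ofPolar_smul_dir hHp (h₁.radius_pos x)]
      have hd1 := (hκd x).1
      simp only [hH, polarModel]
      rw [hS1' _ (by linarith), hX1 _ hd1]
      simp [hk]
    simp only [hF]
    refine ⟨h₂.radius_smul_dir_mem_frontier _, o₂, ho₂, ψ i, cyclicExt ψ (i + 1), μ (τ x), ?_, ?_,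
      cyclicExt_succ_le hψ hψ' i, hψp i, h₂.onRay_radius _, onRay_cyclicExt_succ hψp i⟩
    · rw [← htμ, ← hτθ]
      exact hμm (hτm hx1)
    · rw [← map_cyclicExt hμp htμ, ← map_cyclicExt hτp hτθ]
      exact hμm (hτm hx2)
  · intro z
    have e : jac (fun z => o₂ + ofPolar H (z - o₁)) z = jac (ofPolar H) (z - o₁) := by
      rw [jac, jac, fderiv_const_add, fderiv_comp_sub]
    rw [e]
    by_cases hz : toComplex (z - o₁) = 0
    · have hev : ofPolar H =ᶠ[nhds (z - o₁)] fun _ => 0 := by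
        have hlt : ‖toComplex (z - o₁)‖ < v / M := by
          rw [hz, norm_zero]
          positivity
        filter_upwards [contDiff_toComplex.continuous.norm.continuousAt.eventually_lt
          continuousAt_const hlt] with y hy using hH0 _ hy _
      rw [jac_eq ((hasFDerivAt_const (0 : ℝ × ℝ) (z - o₁)).congr_of_eventuallyEq hev)]
      simpa using pow_nonneg (zero_le_one.trans hc.le) 6
    · obtain ⟨r, x, hr, hrx⟩ : ∃ r x, 0 < r ∧ z - o₁ = r • dir x :=
        ⟨_, _, norm_pos_iff.2 hz, eq_norm_smul_dir_arg (z - o₁)⟩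
      have hjac := jac_ofPolar (hP.differentiable (by simp)) hHp hr x
      rw [hrx]
      have hκx := hκ0 x
      have hbound : |jac H (r, x)| ≤ c ^ 6 * r := by
        rcases lt_or_ge 1 (r * κ x) with h | h
        · rw [jac_polarModel_outer hX hκ hks hμ hρμ hS1' h, abs_zero]
          positivity
        · rw [jac_polarModel_inner hS hκ hμ hρμ hX0 (by linarith)]
          have hS'0 : 0 ≤ deriv S (r * κ x) := hSm.deriv_nonneg
          have hμ'0 : 0 ≤ deriv μ x := hμm.deriv_nonneg
          have hSn := (hS01 (r * κ x)).1
          rw [abs_of_nonneg (by positivity)]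
          -- The factors come from `S' ≤ c`, from `S v ≤ c * v`, and from the areal bound on `μ`;
          -- the powers of `κ` cancel.
          calc _ ≤ c * κ x * (c * (r * κ x)) * (c ^ 4 * (κ x ^ 2)⁻¹) := by
                refine mul_le_mul ?_ (hμc x) (by positivity) (by positivity)
                refine mul_le_mul ?_ (hSle _ (by positivity)) hSn (by positivity)
                exact mul_le_mul_of_nonneg_right (hSc _) hκx.le
            _ = c ^ 6 * r := by field_simp
      rw [← hjac, abs_mul, abs_of_pos hr] at hbound
      exact le_of_mul_le_mul_right hbound hr

/-! ### The Poisson bracket of a composition -/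

section Bracket

variable {E : Type*} [NormedAddCommGroup E] [NormedSpace ℝ E]
  {M : Type*} [TopologicalSpace M] [ChartedSpace E M]

namespace SymplecticForm

theorem dAt_comp {u : ℝ × ℝ → ℝ} {Φ : M → ℝ × ℝ} {x : M} (hu : DifferentiableAt ℝ u (Φ x))
    (hΦ : MDifferentiableAt 𝓘(ℝ, E) 𝓘(ℝ, ℝ × ℝ) Φ x) :
    dAt (E := E) (fun y => u (Φ y)) x =
      fderiv ℝ u (Φ x) (1, 0) • dAt (fun y => (Φ y).1) x +
        fderiv ℝ u (Φ x) (0, 1) • dAt (fun y => (Φ y).2) x := by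
  have key : ∀ {w : ℝ × ℝ → ℝ} {w' : ℝ × ℝ →L[ℝ] ℝ}, HasFDerivAt w w' (Φ x) →
      ∀ ξ, dAt (E := E) (fun y => w (Φ y)) x ξ = w' (mfderiv 𝓘(ℝ, E) 𝓘(ℝ, ℝ × ℝ) Φ x ξ) := by
    intro w w' hw ξ
    have h := (hw.hasMFDerivAt.comp x hΦ.hasMFDerivAt).mfderiv
    exact congrArg (fun A => A ξ) h
  ext ξ
  have h1 := key hu.hasFDerivAt ξ
  have h2 := key (w := Prod.fst) hasFDerivAt_fst ξ
  have h3 := key (w := Prod.snd) hasFDerivAt_snd ξ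
  rw [LinearMap.add_apply, LinearMap.smul_apply, LinearMap.smul_apply, h1, h2, h3]
  set p : ℝ × ℝ := mfderiv 𝓘(ℝ, E) 𝓘(ℝ, ℝ × ℝ) Φ x ξ
  have hp : p = p.1 • ((1 : ℝ), (0 : ℝ)) + p.2 • ((0 : ℝ), (1 : ℝ)) := by
    ext <;> simp
  have : fderiv ℝ u (Φ x) p = p.1 • fderiv ℝ u (Φ x) (1, 0) + p.2 • fderiv ℝ u (Φ x) (0, 1) := by
    conv_lhs => rw [hp]
    rw [map_add, map_smul, map_smul]
  refine this.trans ?_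
  simp only [smul_eq_mul, ContinuousLinearMap.coe_fst', ContinuousLinearMap.coe_snd']
  ring

variable (Ω : SymplecticForm E M)

theorem form_self (x : M) (v : TangentSpace 𝓘(ℝ, E) x) : Ω.form x ![v, v] = 0 :=
  (Ω.form x).map_eq_zero_of_eq ![v, v] (i := 0) (j := 1) rfl (by simp)

theorem flat_comm (x : M) (v w : TangentSpace 𝓘(ℝ, E) x) : Ω.flat x v w = -Ω.flat x w v := by
  have h : Ω.flat x (v + w) (v + w) = 0 := Ω.form_self x _
  have hv : Ω.flat x v v = 0 := Ω.form_self x _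
  have hw : Ω.flat x w w = 0 := Ω.form_self x _
  simp only [map_add, LinearMap.add_apply, hv, hw] at h
  linarith

/-- The bracket at `x` is an alternating bilinear function of the two differentials, so a linear
substitution multiplies it by the determinant. -/
theorem poisson_eq_of_dAt [FiniteDimensional ℝ E] {f g F G : M → ℝ} {x : M} {a b a' b' : ℝ}
    (hF : dAt (E := E) F x = a • dAt f x + b • dAt g x)
    (hG : dAt (E := E) G x = a' • dAt f x + b' • dAt g x) :
    Ω.poisson F G x = (a * b' - b * a') * Ω.poisson f g x := by
  have hXF : Ω.hamVF F x = a • Ω.hamVF f x + b • Ω.hamVF g x := by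
    simp only [hamVF, hF, ← map_smul, ← map_add]
    congr 1
    module
  have hXG : Ω.hamVF G x = a' • Ω.hamVF f x + b' • Ω.hamVF g x := by
    simp only [hamVF, hG, ← map_smul, ← map_add]
    congr 1
    module
  have hff : Ω.flat x (Ω.hamVF f x) (Ω.hamVF f x) = 0 := Ω.form_self x _
  have hgg : Ω.flat x (Ω.hamVF g x) (Ω.hamVF g x) = 0 := Ω.form_self x _
  have hfg := Ω.flat_comm x (Ω.hamVF f x) (Ω.hamVF g x)
  change Ω.flat x (Ω.hamVF G x) (Ω.hamVF F x) =
    (a * b' - b * a') * Ω.flat x (Ω.hamVF g x) (Ω.hamVF f x)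
  rw [hXF, hXG]
  simp only [map_add, map_smul, LinearMap.add_apply, LinearMap.smul_apply, smul_eq_mul, hff, hgg,
    hfg]
  ring

theorem poisson_comp [FiniteDimensional ℝ E] {F : ℝ × ℝ → ℝ × ℝ} {Φ : M → ℝ × ℝ} {x : M}
    (hF : DifferentiableAt ℝ F (Φ x)) (hΦ : MDifferentiableAt 𝓘(ℝ, E) 𝓘(ℝ, ℝ × ℝ) Φ x) :
    Ω.poisson (fun y => (F (Φ y)).1) (fun y => (F (Φ y)).2) x =
      jac F (Φ x) * Ω.poisson (fun y => (Φ y).1) (fun y => (Φ y).2) x := by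
  have e1 := dAt_comp (u := fun z => (F z).1) hF.fst hΦ
  have e2 := dAt_comp (u := fun z => (F z).2) hF.snd hΦ
  rw [Ω.poisson_eq_of_dAt e1 e2, jac_eq hF.hasFDerivAt, fderiv.fst hF, fderiv.snd hF]
  simp

end SymplecticForm

end Bracket

/-- Off the union of the two compact supports `Φ` equals `p`, so `F ∘ Φ` equals `F p`. -/
theorem IsCS.comp {M : Type*} [TopologicalSpace M] [T2Space M] {Δ₁ Δ₂ : Set (ℝ × ℝ)}
    {Φ : M → ℝ × ℝ} (h : IsCS Δ₁ Φ) {F : ℝ × ℝ → ℝ × ℝ} (hF : ∀ z, F z ∈ Δ₂) :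
    IsCS Δ₂ fun x => F (Φ x) := by
  obtain ⟨p, -, h1, h2⟩ := h
  have hout : ∀ x, x ∉ tsupport (fun x => (Φ x).1 - p.1) ∪ tsupport (fun x => (Φ x).2 - p.2) →
      Φ x = p := by
    intro x hx
    rw [mem_union, not_or] at hx
    exact Prod.ext (sub_eq_zero.1 (image_eq_zero_of_notMem_tsupport (f := fun x => (Φ x).1 - p.1) hx.1))
      (sub_eq_zero.1 (image_eq_zero_of_notMem_tsupport (f := fun x => (Φ x).2 - p.2) hx.2))
  refine ⟨F p, hF p, HasCompactSupport.intro (h1.isCompact.union h2.isCompact) fun x hx => ?_,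
    HasCompactSupport.intro (h1.isCompact.union h2.isCompact) fun x hx => ?_⟩ <;>
  simp [hout x hx]

/-! ### Comparison of the invariants of two marked domains -/

section Main

variable {E : Type*} [NormedAddCommGroup E] [NormedSpace ℝ E]
  {M : Type*} [TopologicalSpace M] [T2Space M] [ChartedSpace E M]
  {N : ℕ} [NeZero N]

theorem comp_mem_admissible {X : Fin N → Set M} {D₁ D₂ : MarkedDomain N} {Φ : M → ℝ × ℝ}
    (hΦ : Φ ∈ admissible E D₁ X) {F : ℝ × ℝ → ℝ × ℝ} (hF : ContDiff ℝ ∞ F)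
    (hF₂ : ∀ z, F z ∈ D₂.carrier) (hFa : ∀ i, ∀ z ∈ D₁.arc i, F z ∈ D₂.arc i) :
    (fun x => F (Φ x)) ∈ admissible E D₂ X := by
  obtain ⟨hs, -, hcs, harc⟩ := hΦ
  refine ⟨hF.contMDiff.comp hs, fun x => hF₂ _, hcs.comp hF₂, fun i => ?_⟩
  obtain ⟨U, hU, hXU, hUa⟩ := harc i
  exact ⟨U, hU, hXU, fun x hx => hFa i _ (hUa x hx)⟩

theorem Pb_le_mul [FiniteDimensional ℝ E] (Ω : SymplecticForm E M) (X : Fin N → Set M)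
    (D₁ D₂ : MarkedDomain N) {c : ℝ} (hc : 1 < c) :
    Pb Ω D₂ X ≤ ENNReal.ofReal (c ^ 6) * Pb Ω D₁ X := by
  obtain ⟨F, hF, hF₂, hFa, hFj⟩ := D₁.exists_map D₂ hc
  have hc0 : ENNReal.ofReal (c ^ 6) ≠ 0 := by
    rw [Ne, ENNReal.ofReal_eq_zero, not_le]
    positivity
  have key : ∀ Φ ∈ admissible E D₁ X, Pb Ω D₂ X ≤ ENNReal.ofReal (c ^ 6) *
      ⨆ x : M, ‖Ω.poisson (fun y => (Φ y).1) (fun y => (Φ y).2) x‖ₑ := by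
    intro Φ hΦ
    refine (iInf₂_le _ (comp_mem_admissible hΦ hF hF₂ hFa)).trans (iSup_le fun x => ?_)
    rw [Ω.poisson_comp (hF.differentiable (by simp) _) (hΦ.1.mdifferentiableAt (by simp)),
      enorm_mul]
    refine mul_le_mul' ?_ (le_iSup (fun x : M =>
      ‖Ω.poisson (fun y => (Φ y).1) (fun y => (Φ y).2) x‖ₑ) x)
    rw [Real.enorm_eq_ofReal_abs]
    exact ENNReal.ofReal_le_ofReal (hFj _)
  rw [← ENNReal.div_le_iff' hc0 ENNReal.ofReal_ne_top]
  refine le_iInf₂ fun Φ hΦ => ?_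
  rw [ENNReal.div_le_iff' hc0 ENNReal.ofReal_ne_top]
  exact key Φ hΦ

theorem Pb_le [FiniteDimensional ℝ E] (Ω : SymplecticForm E M) (X : Fin N → Set M)
    (D₁ D₂ : MarkedDomain N) : Pb Ω D₂ X ≤ Pb Ω D₁ X := by
  have hlim : Filter.Tendsto (fun c : ℝ => ENNReal.ofReal (c ^ 6) * Pb Ω D₁ X)
      (nhdsWithin 1 (Ioi 1)) (nhds (ENNReal.ofReal (1 ^ 6) * Pb Ω D₁ X)) := by
    -- The limit factor is `1 ≠ 0`, so the product converges even when the invariant is `∞`.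
    refine ENNReal.Tendsto.mul_const ?_ (Or.inl (by simp))
    exact ((ENNReal.continuous_ofReal.comp (continuous_id.pow 6)).tendsto (1 : ℝ)).mono_left
      nhdsWithin_le_nhds
  rw [one_pow, ENNReal.ofReal_one, one_mul] at hlim
  refine ge_of_tendsto hlim ?_
  filter_upwards [self_mem_nhdsWithin] with c hc
  exact Pb_le_mul Ω X D₁ D₂ hc

end Main

end PoissonInv

end

theorem mainTheorem3
    {E : Type*} [NormedAddCommGroup E] [NormedSpace ℝ E] [FiniteDimensional ℝ E]
    {M : Type*} [TopologicalSpace M] [T2Space M] [SecondCountableTopology M]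
    [ChartedSpace E M] [IsManifold 𝓘(ℝ, E) ∞ M]
    (Ω : PoissonInv.SymplecticForm E M)
    {N : ℕ} [NeZero N] (X : Fin N → Set M)
    (hX : ∀ i, IsCompact (X i)) (hcyc : PoissonInv.IntersectCyclically X)
    (D₁ D₂ : PoissonInv.MarkedDomain N) :
    PoissonInv.Pb Ω D₁ X = PoissonInv.Pb Ω D₂ X :=
  le_antisymm (PoissonInv.Pb_le Ω X D₂ D₁) (PoissonInv.Pb_le Ω X D₁ D₂)
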